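/- **Setting.** A Maya diagram is a set $M\subset\mathbb Z$ containing finitely many non-negative integers and missing finitely many negative ones; it is written $M=(n_1',\dots,n_{r_4}'\,|\,n_1,\dots,n_{r_1})$, where $n_1>\dots>n_{r_1}\ge 0$ are the non-negative integers in $M$ and $n_1'>\dots>n_{r_4}'\ge 0$ are the numbers $-k-1$ for the negative integers $k\notin M$. $M+t=\{k+t:k\in M\}$. The conjugate canonical shift $t'(M)$ is the unique $t\in\mathbb Z$ such that $M+t$ contains no non-negative integer but contains $-1$; if $M+t'(M)=(a_1,\dots,a_s\,|\,\emptyset)$, the conjugate partition of $M$ is $(a_j-s+j)_{j=1}^{s}$, and conversely a partition $(\upsilon_1,\dots,\upsilon_s)$ corresponds to the degrees $a_j=\upsilon_j+s-j$. Let $L_n^{\alpha}(x)=\sum_{k=0}^n(-1)^k\frac{(\alpha+k+1)\cdots(\alpha+n)}{(n-k)!}\frac{x^k}{k!}$, let $M(a,b,x)={}_1F_1(a;b;x)$, and $\widetilde h^{\alpha}(x,\lambda)=x^{-\alpha}M(-\lambda-\alpha,1-\alpha,x)$ for $\alpha\notin\{1,2,\dots\}$. For Maya diagrams $M_1=(n_1',\dots,n_{r_4}'\,|\,n_1,\dots,n_{r_1})$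 and $M_2=(m_1',\dots,m_{r_3}'\,|\,m_1,\dots,m_{r_2})$ put $r=r_1+r_2+r_3+r_4$, let $f_1,\dots,f_r$ be the functions $L_{n_j}^{\alpha}(x)$, $e^xL_{m_j}^{\alpha}(-x)$, $x^{-\alpha}L_{m_j'}^{-\alpha}(x)$, $e^xx^{-\alpha}L_{n_j'}^{-\alpha}(-x)$ in this order, and $$\Omega_{M_1,M_2}[\widetilde h^{\alpha}(x,\lambda)]=e^{-(r_2+r_4)x}\,x^{(\alpha+r_1+r_2)(r_3+r_4+1)}\,\mathrm{Wr}[f_1,\dots,f_r,\widetilde h^{\alpha}(\cdot,\lambda)](x),\qquad x>0 .$$ For partitions $\mu',\nu'$, $\Omega_{\mu',\nu'}[\cdot]$ denotes the same expression with $r_1=r_2=0$, with $n'$ the degree sequence of $\mu'$ and with $m'$ the degree sequence of $\nu'$. Write $z^{(n)}=z(z+1)\cdots(z+n-1)$ and $z_{(n)}=z(z-1)\cdots(z-n+1)$. **Theorem.** Let $M_1,M_2$ be Maya diagrams, let $t_1'=t'(M_1)$, $t_2'=t'(M_2)$, and let $\mu',\nu'$ be the conjugate partitions of $M_1,M_2$.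 There is $d\in\mathbb N$, depending only on $M_1$ and $M_2$, such that for all $\alpha\in\mathbb R$ and $\lambda\in\mathbb C$ satisfying * none of $\alpha$, $\alpha-t_1'$, $\alpha-t_1'-t_2'$ is a positive integer, * $\lambda\ne k$ for all integers $0\le k<-t_1'$ with $k\notin M_1$, and $\lambda\neq-\alpha-1-k$ for all integers $0\le k<-t_2'$ with $k\notin M_2$ (so that all the functions and constants below are defined), and for all $x>0$, $$\Omega_{M_1,M_2}[\widetilde h^{\alpha}(x,\lambda)]=(-1)^d\,D_1D_2D_3\;\Omega_{\mu',\nu'}[\widetilde h^{\alpha-t_1'-t_2'}(x,\lambda+t_1')],$$ where $$D_1=\begin{cases}\dfrac{(-\alpha)_{(|t_1'|)}}{\prod_{k}(\lambda-k)}&t_1'<0\\ 1&t_1'=0\\ \dfrac{(\lambda+1)^{(t_1')}}{(1-\alpha)^{(t_1')}}&t_1'>0\end{cases}\qquad D_2=\begin{cases}\dfrac{(-\alpha+t_1')_{(|t_2'|)}}{\prod_{k}(-\lambda-\alpha-1-k)}&t_2'<0\\ 1&t_2'=0\\ \dfrac{(-\lambda-\alpha)^{(t_2')}}{(1-\alpha+t_1')^{(t_2')}}&t_2'>0\end{cases}$$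 (the product in $D_1$ runs over $0\le k<|t_1'|$ with $k\notin\{n_j\}_{j=1}^{r_1}$, the one in $D_2$ over $0\le k<|t_2'|$ with $k\notin\{m_j\}_{j=1}^{r_2}$), and $$D_3=\prod_{j=1}^{r_1}\prod_{k=1}^{r_3}(n_j+\alpha-m_k')\prod_{j=1}^{r_2}\prod_{k=1}^{r_4}(m_j+\alpha-n_k')\prod_{j=1}^{r_1}\prod_{k=1}^{r_4}(n_j+n_k'+1)\prod_{j=1}^{r_2}\prod_{k=1}^{r_3}(m_j+m_k'+1).$$ -/

import Mathlib

namespace ExcLaguerre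

/-- A Maya diagram: a set of integers (the filled boxes) which contains only finitely many
non-negative integers and misses only finitely many negative integers. -/
@[ext]
structure MayaDiagram where
  carrier : Set ℤ
  finite_filled : {n : ℕ | (n : ℤ) ∈ carrier}.Finite
  finite_empty : {n : ℕ | -(n : ℤ) - 1 ∉ carrier}.Finite

namespace MayaDiagram

/-- The filled boxes `n ≥ 0` to the right of the origin. -/
noncomputable def filled (M : MayaDiagram) : Finset ℕ := M.finite_filled.toFinset

/-- The labels `n = -k - 1 ≥ 0` of the empty boxes `k < 0` to the left of the origin. -/
noncomputable def empty (M : MayaDiagram) : Finset ℕ := M.finite_empty.toFinset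

/-- The decreasing sequence of the filled boxes to the right of the origin. -/
noncomputable def filledSeq (M : MayaDiagram) : List ℕ := M.filled.sort (· ≥ ·)

/-- The decreasing sequence of the labels of the empty boxes to the left of the origin. -/
noncomputable def emptySeq (M : MayaDiagram) : List ℕ := M.empty.sort (· ≥ ·)

theorem exists_upper (M : MayaDiagram) : ∃ B : ℕ, ∀ k ∈ M.carrier, k < (B : ℤ) := by
  obtain ⟨B, hB⟩ := M.finite_filled.bddAbove
  refine ⟨B + 1, fun k hk => ?_⟩
  by_cases h : 0 ≤ k
  · lift k to ℕ using h
    have : k ≤ B := hB hk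
    omega
  · omega

theorem exists_lower (M : MayaDiagram) : ∃ B : ℕ, ∀ k : ℤ, k ∉ M.carrier → -(B : ℤ) ≤ k := by
  obtain ⟨B, hB⟩ := M.finite_empty.bddAbove
  refine ⟨B + 1, fun k hk => ?_⟩
  by_cases h : 0 ≤ k
  · omega
  · obtain ⟨n, hn⟩ : ∃ n : ℕ, (n : ℤ) = -k - 1 := ⟨(-k - 1).toNat, by omega⟩
    have h1 : n ∈ {n : ℕ | -(n : ℤ) - 1 ∉ M.carrier} := by
      have h2 : -(n : ℤ) - 1 = k := by omega
      simpa [h2] using hk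
    have : n ≤ B := hB h1
    omega

/-- The translated diagram `M + t`. -/
def shift (M : MayaDiagram) (t : ℤ) : MayaDiagram where
  carrier := {k : ℤ | k - t ∈ M.carrier}
  finite_filled := by
    obtain ⟨B, hB⟩ := M.exists_upper
    refine (Set.finite_Iic (B + t.natAbs)).subset fun n hn => ?_
    have := hB _ hn
    simp only [Set.mem_Iic]
    omega
  finite_empty := by
    obtain ⟨B, hB⟩ := M.exists_lower
    refine (Set.finite_Iic (B + t.natAbs)).subset fun n hn => ?_
    have := hB _ hn
    simp only [Set.mem_Iic]
    omega

/-- Conjugate canonical form: no box to the right of the origin is filled, and the first box to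
the left of the origin is filled. -/
def IsConjCanonical (M : MayaDiagram) : Prop :=
  (∀ k : ℤ, 0 ≤ k → k ∉ M.carrier) ∧ (-1 : ℤ) ∈ M.carrier

theorem existsUnique_conjCanonical (M : MayaDiagram) :
    ∃! t : ℤ, (M.shift t).IsConjCanonical := by
  obtain ⟨B, hB⟩ := M.exists_upper
  obtain ⟨C, hC⟩ := M.exists_lower
  obtain ⟨m, hm, hmax⟩ := Int.exists_greatest_of_bdd (P := fun k => k ∈ M.carrier)
    ⟨B, fun k hk => (hB k hk).le⟩
    ⟨-(C : ℤ) - 1, by by_contra h; have := hC _ h; omega⟩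
  refine ⟨-(m + 1), ⟨fun k hk hmem => ?_, ?_⟩, fun t ht => ?_⟩
  · have := hmax _ (show k - -(m + 1) ∈ M.carrier from hmem)
    omega
  · change (-1 : ℤ) - -(m + 1) ∈ M.carrier
    simpa using hm
  · have h1 : (-1 : ℤ) - t ≤ m := hmax _ (show (-1 : ℤ) - t ∈ M.carrier from ht.2)
    by_contra hne
    refine ht.1 (m + t) (by omega) ?_
    change m + t - t ∈ M.carrier
    simpa using hm

/-- The shift that puts `M` into conjugate canonical form. -/
noncomputable def conjShift (M : MayaDiagram) : ℤ := M.existsUnique_conjCanonical.choose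

theorem conjShift_spec (M : MayaDiagram) : (M.shift M.conjShift).IsConjCanonical :=
  M.existsUnique_conjCanonical.choose_spec.1

/-- The conjugate partition `(μ₁ ≥ … ≥ μ_r)` of `M`: if `n₁ > … > n_r` are the labels of the empty
boxes of the conjugate canonical form of `M`, then `μ_j = n_j - r + j`. (Positions in a list start
at `0`.) -/
noncomputable def conjPartition (M : MayaDiagram) : List ℕ :=
  let s := (M.shift M.conjShift).emptySeq
  s.mapIdx fun j n => n - (s.length - (j + 1))

end MayaDiagram

/-- The strictly decreasing sequence `n_j = μ_j + r - j` that belongs to a partition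
`(μ₁ ≥ … ≥ μ_r)`. -/
def partitionDegrees (p : List ℕ) : List ℕ :=
  p.mapIdx fun j a => a + (p.length - (j + 1))

/-- The generalized Laguerre polynomial
`L_n^α(x) = ∑_{k ≤ n} (-1)^k ((α+k+1)(α+k+2)⋯(α+n) / (n-k)!) x^k / k!`. -/
noncomputable def laguerre (n : ℕ) (α x : ℝ) : ℝ :=
  ∑ k ∈ Finset.range (n + 1),
    (-1) ^ k * ((ascPochhammer ℝ (n - k)).eval (α + k + 1) / (n - k).factorial)
      * (x ^ k / k.factorial)

/-- Kummer's confluent hypergeometric function `M(a, b, z) = ₁F₁(a; b; z)`,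
for `b ∉ {0, -1, -2, …}`. -/
noncomputable def kummerM (a b z : ℂ) : ℂ :=
  ∑' k : ℕ, (ascPochhammer ℂ k).eval a / (ascPochhammer ℂ k).eval b * (z ^ k / k.factorial)

/-- The second solution `x^{-α} M(-lam - α, 1 - α, x)` of the classical Laguerre equation with
spectral parameter `lam`, for `α ∉ {1, 2, 3, …}`. -/
noncomputable def hTilde (α : ℝ) (lam : ℂ) (x : ℝ) : ℂ :=
  ((x ^ (-α) : ℝ) : ℂ) * kummerM (-lam - α) (1 - α) x

/-- The Wronskian `Wr[f₁, …, f_s](x)`. -/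
noncomputable def wronskian (F : List (ℝ → ℂ)) (x : ℝ) : ℂ :=
  (Matrix.of fun i j : Fin F.length => iteratedDeriv (i : ℕ) (F.get j) x).det

/-- The seed functions `L_n^α(x)`. -/
noncomputable def seed1 (α : ℝ) (n : ℕ) (x : ℝ) : ℂ := ((laguerre n α x : ℝ) : ℂ)

/-- The seed functions `e^x L_m^α(-x)`. -/
noncomputable def seed2 (α : ℝ) (m : ℕ) (x : ℝ) : ℂ :=
  ((Real.exp x * laguerre m α (-x) : ℝ) : ℂ)

/-- The seed functions `x^{-α} L_m^{-α}(x)`. -/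
noncomputable def seed3 (α : ℝ) (m : ℕ) (x : ℝ) : ℂ :=
  ((x ^ (-α) * laguerre m (-α) x : ℝ) : ℂ)

/-- The seed functions `e^x x^{-α} L_n^{-α}(-x)`. -/
noncomputable def seed4 (α : ℝ) (n : ℕ) (x : ℝ) : ℂ :=
  ((Real.exp x * x ^ (-α) * laguerre n (-α) (-x) : ℝ) : ℂ)

/-- `e^{-(r₂+r₄)x} x^{(α+r₁+r₂)(r₃+r₄+1)} Wr[f₁, …, f_r, g](x)`, where the seed functions
`f₁, …, f_r` with parameter `α` are, in this order, of the four kinds above with degrees from the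
sequences `n`, `m`, `m'`, `n'` of lengths `r₁`, `r₂`, `r₃`, `r₄`. -/
noncomputable def omegaSeq (n m m' n' : List ℕ) (α : ℝ) (g : ℝ → ℂ) (x : ℝ) : ℂ :=
  ((Real.exp (-((m.length + n'.length : ℕ) : ℝ) * x) *
      x ^ ((α + n.length + m.length) * (m'.length + n'.length + 1)) : ℝ) : ℂ) *
    wronskian (n.map (seed1 α) ++ m.map (seed2 α) ++ m'.map (seed3 α) ++ n'.map (seed4 α) ++ [g]) x

/-- The solution of the second kind `Ω_{M₁,M₂}[h̃^α(x, lam)]`. -/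
noncomputable def omegaMaya (M₁ M₂ : MayaDiagram) (α : ℝ) (lam : ℂ) (x : ℝ) : ℂ :=
  omegaSeq M₁.filledSeq M₂.filledSeq M₂.emptySeq M₁.emptySeq α (hTilde α lam) x

/-- `Ω_{μ',ν'}[h̃^α(x, lam)]` for conjugate partitions `μ'`, `ν'`: the two Maya diagrams are in
conjugate canonical form, so that only seed functions of the last two kinds occur. -/
noncomputable def omegaConj (μ' ν' : List ℕ) (α : ℝ) (lam : ℂ) (x : ℝ) : ℂ :=
  omegaSeq [] [] (partitionDegrees ν') (partitionDegrees μ') α (hTilde α lam) x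

/-- The constant `D₁(α, lam, M₁)`. Rising factorials `z(z+1)⋯(z+n-1)` and falling factorials
`z(z-1)⋯(z-n+1)` are the values of `ascPochhammer` and `descPochhammer`. -/
noncomputable def D₁ (α : ℝ) (lam : ℂ) (M₁ : MayaDiagram) : ℂ :=
  let t := M₁.conjShift
  if t < 0 then
    (descPochhammer ℂ t.natAbs).eval (-(α : ℂ)) /
      ∏ k ∈ Finset.range t.natAbs \ M₁.filled, (lam - k)
  else if t = 0 then 1
  else (ascPochhammer ℂ t.natAbs).eval (lam + 1) / (ascPochhammer ℂ t.natAbs).eval (1 - (α : ℂ))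

/-- The constant `D₂(α, lam, M₂)`, which also depends on the shift `t₁` of the first diagram. -/
noncomputable def D₂ (α : ℝ) (lam : ℂ) (t₁ : ℤ) (M₂ : MayaDiagram) : ℂ :=
  let t := M₂.conjShift
  if t < 0 then
    (descPochhammer ℂ t.natAbs).eval (-(α : ℂ) + t₁) /
      ∏ k ∈ Finset.range t.natAbs \ M₂.filled, (-lam - α - 1 - k)
  else if t = 0 then 1
  else (ascPochhammer ℂ t.natAbs).eval (-lam - α) /
    (ascPochhammer ℂ t.natAbs).eval (1 - (α : ℂ) + t₁)

/-- The constant `D₃(α, M₁, M₂)`. -/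
noncomputable def D₃ (α : ℝ) (M₁ M₂ : MayaDiagram) : ℂ :=
  (∏ n ∈ M₁.filled, ∏ m' ∈ M₂.empty, ((n : ℂ) + α - m')) *
    (∏ m ∈ M₂.filled, ∏ n' ∈ M₁.empty, ((m : ℂ) + α - n')) *
    (∏ n ∈ M₁.filled, ∏ n' ∈ M₁.empty, ((n : ℂ) + n' + 1)) *
    (∏ m ∈ M₂.filled, ∏ m' ∈ M₂.empty, ((m : ℂ) + m' + 1))

end ExcLaguerre

namespace ExcLaguerre

open Filter Topology

/-! Moving one diagram by a single box multiplies the Wronskian by an explicit factor; the theorem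
is a composition of such moves. If `0 ∈ M₁`, the constant seed `L_0^α = 1` occurs, and `Wr[1, f, …]
= Wr[f', …]`. The derivative of each remaining function is a multiple of a function of the same kind
with parameter `α + 1`: degrees `n` drop by one, degrees `n'` grow by one, and `λ` becomes `λ - 1`.
This is the configuration of `M₁ - 1`. If `0 ∉ M₁`, then `M₁ - 1` has the seed `e^x x^{-α-1}` at
parameter `α + 1`; dividing all functions by it and differentiating leads back from `M₁ - 1` to
`M₁`. For `M₂` the seeds `e^x` and `x^{-α-1}` play these two roles.

The products over seeds created by a move are, up to sign, the change in `D₃`. Hence `R = Ω / D₃`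
satisfies one recursion in both cases, `R(M, α, μ) = ± (-α / c) R(M - 1, α + 1, μ - 1)` with `c = 1`
if `0 ∈ M` and `c = μ` otherwise. Here `μ = λ` for `M₁` and `μ = -λ - α - 1` for `M₂`
(`exists_normOmega_shift_left`, `exists_normOmega_shift_right`). Iterating it up to the conjugate
canonical form produces `D₁` and `D₂` (`exists_conjShift_eq`).

All divisions are legitimate for generic parameters. The remaining ones are limits along `(α + ε, λ
+ iε)`: both sides are continuous at `ε = 0`, and the sign survives the limit because it depends on
the two diagrams alone. -/

/-! ### Wronskians: permutation, common factors, reduction of order. -/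

/-- The Wronskian of a finite family of functions. -/
noncomputable def wronskianFin {n : ℕ} (f : Fin n → ℝ → ℂ) (x : ℝ) : ℂ :=
  (Matrix.of fun i j : Fin n => iteratedDeriv (i : ℕ) (f j) x).det

theorem wronskianFin_cast {n m : ℕ} (h : n = m) (f : Fin m → ℝ → ℂ) (x : ℝ) :
    wronskianFin (fun i => f (Fin.cast h i)) x = wronskianFin f x := by
  subst h
  rfl

theorem wronskian_map {ι : Type*} (l : List ι) (F : ι → ℝ → ℂ) (x : ℝ) :
    wronskian (l.map F) x = wronskianFin (fun i => F (l.get i)) x := by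
  rw [← wronskianFin_cast (l.length_map (f := F)) (fun i => F (l.get i)) x]
  unfold wronskian wronskianFin
  congr
  ext i j
  simp

theorem wronskianFin_perm {n : ℕ} (σ : Equiv.Perm (Fin n)) (f : Fin n → ℝ → ℂ) (x : ℝ) :
    wronskianFin (fun i => f (σ i)) x = ((Equiv.Perm.sign σ : ℤ) : ℂ) * wronskianFin f x := by
  unfold wronskianFin
  rw [← Matrix.det_permute']
  rfl

/-- The bijection of positions is found on the labels, before any functions are attached to them;
this makes the resulting sign independent of `α`, `λ` and `x`. Induction over the generators of
`List.Perm`. -/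
theorem exists_equiv_of_perm {ι : Type*} {l₁ l₂ : List ι} (h : l₁.Perm l₂) :
    ∃ e : Fin l₁.length ≃ Fin l₂.length, ∀ i, l₁.get i = l₂.get (e i) := by
  induction h with
  | nil => exact ⟨Equiv.refl _, fun _ => rfl⟩
  | cons a _ ih =>
    obtain ⟨e, he⟩ := ih
    refine ⟨(finSuccEquiv _).trans ((Equiv.optionCongr e).trans (finSuccEquiv _).symm), ?_⟩
    intro i
    refine Fin.cases ?_ (fun j => ?_) i
    · simp
    · simpa using he j
  | swap a b l =>
    refine ⟨(Equiv.swap (0 : Fin (l.length + 2)) 1), fun i => ?_⟩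
    change Fin (l.length + 2) at i
    refine Fin.cases ?_ (fun j => Fin.cases ?_ (fun k => ?_) j) i
    · simp
    · change (b :: a :: l).get 1 = (a :: b :: l).get (Equiv.swap 0 1 1)
      simp
    · have : Equiv.swap (0 : Fin (l.length + 2)) 1 k.succ.succ = k.succ.succ :=
        Equiv.swap_apply_of_ne_of_ne (Fin.succ_ne_zero _)
          (fun h => Fin.succ_ne_zero k (Fin.succ_injective _ h))
      rw [this]
      rfl
  | trans _ _ ih₁ ih₂ =>
    obtain ⟨e₁, h₁⟩ := ih₁
    obtain ⟨e₂, h₂⟩ := ih₂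
    exact ⟨e₁.trans e₂, fun i => (h₁ i).trans (h₂ (e₁ i))⟩

/-- Permuting the functions multiplies the Wronskian by a sign that does not depend on them. -/
theorem wronskian_perm {ι : Type*} {l₁ l₂ : List ι} (h : l₁.Perm l₂) :
    ∃ d : ℕ, ∀ (F : ι → ℝ → ℂ) (x : ℝ),
      wronskian (l₁.map F) x = (-1) ^ d * wronskian (l₂.map F) x := by
  obtain ⟨e, he⟩ := exists_equiv_of_perm h
  let σ : Equiv.Perm (Fin l₁.length) := e.trans (finCongr h.length_eq.symm)
  obtain ⟨d, hd⟩ : ∃ d : ℕ, ((Equiv.Perm.sign σ : ℤ) : ℂ) = (-1) ^ d := by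
    rcases Int.units_eq_one_or (Equiv.Perm.sign σ) with h | h
    · exact ⟨0, by simp [h]⟩
    · exact ⟨1, by simp [h]⟩
  refine ⟨d, fun F x => ?_⟩
  rw [wronskian_map, wronskian_map, ← hd, ← wronskianFin_cast h.length_eq,
    ← wronskianFin_perm]
  congr 1
  funext i
  rw [he]
  rfl

theorem wronskianFin_congr {n : ℕ} {f g : Fin n → ℝ → ℂ} {x : ℝ}
    (h : ∀ i, f i =ᶠ[𝓝 x] g i) : wronskianFin f x = wronskianFin g x := by
  unfold wronskianFin
  congr 1
  ext i j
  exact (h j).iteratedDeriv_eq _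

theorem wronskianFin_const_mul {n : ℕ} (c : Fin n → ℂ) (f : Fin n → ℝ → ℂ) (x : ℝ) :
    wronskianFin (fun i y => c i * f i y) x = (∏ i, c i) * wronskianFin f x := by
  unfold wronskianFin
  rw [← Matrix.det_mul_row]
  congr 1
  ext i j
  simp

/-- By the Leibniz rule the Wronskian matrix of the products is `L` times that of the `f i`, where
`L` is lower triangular with diagonal entries `g x`. -/
theorem wronskianFin_mul {n : ℕ} {g : ℝ → ℂ} {f : Fin n → ℝ → ℂ} {x : ℝ}
    (hg : ∀ k : ℕ, ContDiffAt ℝ k g x) (hf : ∀ i, ∀ k : ℕ, ContDiffAt ℝ k (f i) x) :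
    wronskianFin (fun i y => g y * f i y) x = g x ^ n * wronskianFin f x := by
  let L : Matrix (Fin n) (Fin n) ℂ := Matrix.of fun i k =>
    if k ≤ i then ((i : ℕ).choose k : ℂ) * iteratedDeriv ((i : ℕ) - k) g x else 0
  have hL : L.det = g x ^ n := by
    rw [Matrix.det_of_isLowerTriangular]
    · simp [L]
    · intro i j hij
      have : ¬ j ≤ i := by simpa using hij
      simp [L, this]
  unfold wronskianFin
  rw [← hL, ← Matrix.det_mul]
  congr 1
  ext i j
  have h1 := iteratedDeriv_fun_mul (n := (i : ℕ)) (hf j i) (hg i)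
  simp only [Matrix.of_apply, Matrix.mul_apply, L]
  rw [show (fun y => g y * f j y) = fun y => f j y * g y by ext; ring, h1,
    Finset.sum_fin_eq_sum_range]
  rw [Finset.sum_subset (s₂ := Finset.range n)]
  · refine Finset.sum_congr rfl fun k hk => ?_
    have hk := Finset.mem_range.1 hk
    rw [dif_pos hk]
    by_cases hki : k ≤ i
    · rw [if_pos (by simpa [Fin.le_def] using hki)]
      ring
    · rw [if_neg (by simpa [Fin.le_def] using hki), Nat.choose_eq_zero_of_lt (by omega)]
      simp
  · intro k hk
    simp only [Finset.mem_range] at hk ⊢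
    omega
  · intro k hk hk'
    simp only [Finset.mem_range] at hk hk'
    simp [Nat.choose_eq_zero_of_lt (show (i : ℕ) < k by omega)]

/-- The first column is `(1, 0, …, 0)`, so expansion along it leaves the minor of derivatives. -/
theorem wronskianFin_one_cons {n : ℕ} {f : Fin (n + 1) → ℝ → ℂ} {x : ℝ}
    (h : f 0 =ᶠ[𝓝 x] fun _ => 1) :
    wronskianFin f x = wronskianFin (fun i => deriv (f i.succ)) x := by
  unfold wronskianFin
  rw [Matrix.det_succ_column_zero, Finset.sum_eq_single 0]
  · simp only [Matrix.of_apply, Fin.val_zero, iteratedDeriv_zero, h.eq_of_nhds]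
    simp only [pow_zero, one_mul]
    congr 1
    ext i j
    simp [iteratedDeriv_succ']
  · intro i _ hi
    have : iteratedDeriv (i : ℕ) (f 0) x = 0 := by
      rw [h.iteratedDeriv_eq, iteratedDeriv_const, if_neg (fun h : (i : ℕ) = 0 => hi (Fin.ext h))]
    simp [this]
  · simp

/-- With `v = 1 / f 0` the scaled family starts with the constant `1`; the others are replaced by
their derivatives, from which the constants `c i` and the common factor `w` are pulled out. -/
theorem wronskianFin_succ_eq {n : ℕ} {f : Fin (n + 1) → ℝ → ℂ} {g : Fin n → ℝ → ℂ}
    {c : Fin n → ℂ} {v w : ℝ → ℂ} {x : ℝ}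
    (hv : ∀ k : ℕ, ContDiffAt ℝ k v x) (hw : ∀ k : ℕ, ContDiffAt ℝ k w x)
    (hf : ∀ i, ∀ k : ℕ, ContDiffAt ℝ k (f i) x) (hg : ∀ i, ∀ k : ℕ, ContDiffAt ℝ k (g i) x)
    (h0 : (fun y => v y * f 0 y) =ᶠ[𝓝 x] fun _ => 1)
    (h : ∀ i, deriv (fun y => v y * f i.succ y) =ᶠ[𝓝 x] fun y => c i * (w y * g i y)) :
    v x ^ (n + 1) * wronskianFin f x = (∏ i, c i) * (w x ^ n * wronskianFin g x) := by
  rw [← wronskianFin_mul hv hf, wronskianFin_one_cons h0, wronskianFin_congr h,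
    wronskianFin_const_mul, wronskianFin_mul hw hg]

/-- If `v · F i₀ = 1` and `(v · F i)' = c i · w · G (σ i)`, then the Wronskian of the functions
`F i₀, F i` is expressed by the one of the functions `G (σ i)`. -/
theorem wronskian_cons_eq {ι κ : Type*} {F : ι → ℝ → ℂ} {G : κ → ℝ → ℂ} {σ : ι → κ} {c : ι → ℂ}
    {v w : ℝ → ℂ} {i₀ : ι} {l : List ι} {x : ℝ} (hx : 0 < x)
    (hv : ∀ k : ℕ, ContDiffAt ℝ k v x) (hw : ∀ k : ℕ, ContDiffAt ℝ k w x)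
    (hF : ∀ i, ∀ k : ℕ, ContDiffAt ℝ k (F i) x) (hG : ∀ i, ∀ k : ℕ, ContDiffAt ℝ k (G i) x)
    (h0 : ∀ y : ℝ, 0 < y → v y * F i₀ y = 1)
    (h : ∀ i ∈ l, ∀ y : ℝ, 0 < y →
      HasDerivAt (fun y => v y * F i y) (c i * (w y * G (σ i) y)) y) :
    v x ^ (l.length + 1) * wronskian ((i₀ :: l).map F) x =
      (l.map c).prod * (w x ^ l.length * wronskian ((l.map σ).map G) x) := by
  have hpos : ∀ᶠ y in 𝓝 x, 0 < y := lt_mem_nhds hx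
  rw [List.map_map, wronskian_map, wronskian_map]
  have := wronskianFin_succ_eq (n := l.length) (f := fun i => F ((i₀ :: l).get i))
    (g := fun i => G (σ (l.get i))) (c := fun i => c (l.get i)) hv hw (fun i => hF _)
    (fun i => hG _) (hpos.mono fun y hy => h0 y hy)
    (fun i => hpos.mono fun y hy => (h (l.get i) (List.get_mem _ _) y hy).deriv)
  rw [show (l.map c).prod = ∏ i, c (l.get i) by
    rw [← List.prod_ofFn]; congr 1; exact List.ext_getElem (by simp) (by simp)]
  exact this

/-! ### Exponential generating functions with geometrically bounded coefficients. -/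

/-- The exponential generating function `∑ c_k z^k / k!`. -/
noncomputable def egf (c : ℕ → ℂ) (z : ℂ) : ℂ := ∑' k : ℕ, c k * (z ^ k / k.factorial)

/-- The sequence `c` grows at most geometrically. -/
def GeomBdd (c : ℕ → ℂ) : Prop := ∃ C R : ℝ, 0 ≤ C ∧ 0 ≤ R ∧ ∀ k, ‖c k‖ ≤ C * R ^ k

theorem norm_egf_term_le {c : ℕ → ℂ} {C R : ℝ} (h : ∀ k, ‖c k‖ ≤ C * R ^ k) (z : ℂ) (k : ℕ) :
    ‖c k * (z ^ k / k.factorial)‖ ≤ C * ((R * ‖z‖) ^ k / k.factorial) := by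
  rw [norm_mul, norm_div, norm_pow, Complex.norm_natCast, mul_pow]
  calc _ ≤ C * R ^ k * (‖z‖ ^ k / k.factorial) := by gcongr; exact h k
    _ = _ := by ring

theorem GeomBdd.summable {c : ℕ → ℂ} (h : GeomBdd c) (z : ℂ) :
    Summable fun k : ℕ => c k * (z ^ k / k.factorial) := by
  obtain ⟨C, R, _, _, hc⟩ := h
  exact .of_norm_bounded ((Real.summable_pow_div_factorial _).mul_left C)
    (norm_egf_term_le hc z)

theorem GeomBdd.hasSum {c : ℕ → ℂ} (h : GeomBdd c) (z : ℂ) :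
    HasSum (fun k : ℕ => c k * (z ^ k / k.factorial)) (egf c z) := (h.summable z).hasSum

theorem GeomBdd.shift {c : ℕ → ℂ} (h : GeomBdd c) : GeomBdd fun k => c (k + 1) := by
  obtain ⟨C, R, hC, hR, hc⟩ := h
  exact ⟨C * R, R, by positivity, hR, fun k => (hc _).trans (le_of_eq (by ring))⟩

/-- Termwise differentiation, justified by a summable bound on the ball of radius `‖z‖ + 1`. -/
theorem hasDerivAt_egf {c : ℕ → ℂ} (h : GeomBdd c) (z : ℂ) :
    HasDerivAt (egf c) (egf (fun k => c (k + 1)) z) z := by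
  have hterm : ∀ (k : ℕ) (y : ℂ), c (k + 1) * (((k + 1 : ℕ) : ℂ) * y ^ k / (k + 1).factorial)
      = c (k + 1) * (y ^ k / k.factorial) := fun k y => by
    have : ((k : ℂ) + 1) ≠ 0 := by exact_mod_cast Nat.succ_ne_zero k
    have : (k.factorial : ℂ) ≠ 0 := by exact_mod_cast k.factorial_ne_zero
    rw [Nat.factorial_succ]
    push_cast
    field_simp
  have hsum : egf (fun k => c (k + 1)) z
      = ∑' k : ℕ, c k * ((k : ℂ) * z ^ (k - 1) / k.factorial) := by
    rw [Summable.tsum_eq_zero_add]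
    · simp only [egf, ← hterm]
      simp
    · rw [← summable_nat_add_iff 1]
      simpa only [← hterm, Nat.add_sub_cancel] using h.shift.summable z
  rw [hsum]
  obtain ⟨C, R, hC, hR, hc⟩ := h.shift
  -- The derivative of term `k + 1` is term `k` of the shifted series, and term `0` has derivative
  -- `0`; the bound is therefore `0` followed by the bound for the shifted series.
  let u : ℕ → ℝ := fun k => Nat.casesOn k 0 fun k =>
    C * ((R * (‖z‖ + 1)) ^ k / k.factorial)
  have hu : Summable u :=
    (summable_nat_add_iff 1).1 ((Real.summable_pow_div_factorial (R * (‖z‖ + 1))).mul_left C)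
  have hz : z ∈ Metric.ball (0 : ℂ) (‖z‖ + 1) := by simp
  refine hasDerivAt_tsum_of_isPreconnected (g := fun k y => c k * (y ^ k / k.factorial))
    (g' := fun k y => c k * ((k : ℂ) * y ^ (k - 1) / k.factorial)) hu
    Metric.isOpen_ball (convex_ball (0 : ℂ) (‖z‖ + 1)).isPreconnected ?_ ?_ hz (h.summable z) hz
  · intro k y _
    exact ((hasDerivAt_pow k y).div_const _).const_mul _
  · intro k y hy
    cases k with
    | zero => simp [u]
    | succ k =>
      rw [Nat.add_sub_cancel, hterm]
      refine (norm_egf_term_le hc y k).trans ?_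
      have : ‖y‖ ≤ ‖z‖ + 1 := by simpa using (Metric.mem_ball.1 hy).le
      change _ ≤ C * ((R * (‖z‖ + 1)) ^ k / k.factorial)
      gcongr

theorem hasDerivAt_egf_ofReal {c : ℕ → ℂ} (h : GeomBdd c) (x : ℝ) :
    HasDerivAt (fun x : ℝ => egf c x) (egf (fun k => c (k + 1)) x) x :=
  (hasDerivAt_egf h x).comp_ofReal

theorem iteratedDeriv_egf (n : ℕ) {c : ℕ → ℂ} (h : GeomBdd c) :
    iteratedDeriv n (fun x : ℝ => egf c x) = fun x : ℝ => egf (fun k => c (k + n)) x := by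
  induction n generalizing c with
  | zero => simp
  | succ n ih =>
    have : deriv (fun x : ℝ => egf c x) = fun x : ℝ => egf (fun k => c (k + 1)) x :=
      funext fun x => (hasDerivAt_egf_ofReal h x).deriv
    rw [iteratedDeriv_succ', this, ih h.shift]
    simp only [add_assoc, add_comm n 1]

theorem contDiff_egf (n : ℕ) {c : ℕ → ℂ} (h : GeomBdd c) :
    ContDiff ℝ n (fun x : ℝ => egf c x) := by
  induction n generalizing c with
  | zero =>
    exact contDiff_zero.2 (continuous_iff_continuousAt.2 fun x =>
      (hasDerivAt_egf_ofReal h x).continuousAt)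
  | succ n ih =>
    rw [Nat.cast_succ]
    refine contDiff_succ_iff_deriv.2 ⟨fun x => (hasDerivAt_egf_ofReal h x).differentiableAt,
      by simp, ?_⟩
    have : deriv (fun x : ℝ => egf c x) = fun x : ℝ => egf (fun k => c (k + 1)) x :=
      funext fun x => (hasDerivAt_egf_ofReal h x).deriv
    rw [this]
    exact ih h.shift

/-- Dominated convergence. A single geometric bound valid for all nearby parameters is what makes
the limit legitimate. -/
theorem continuousAt_egf {c : ℝ → ℕ → ℂ} {ε : ℝ} {C R : ℝ}
    (hb : ∀ᶠ t in 𝓝 ε, ∀ k, ‖c t k‖ ≤ C * R ^ k)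
    (hc : ∀ k, ContinuousAt (fun t => c t k) ε) (z : ℂ) :
    ContinuousAt (fun t => egf (c t) z) ε := by
  refine tendsto_tsum_of_dominated_convergence (bound := fun k : ℕ =>
    C * ((R * ‖z‖) ^ k / k.factorial)) ((Real.summable_pow_div_factorial _).mul_left C)
    (fun k => (hc k).mul_const _) (hb.mono fun t ht k => norm_egf_term_le ht z k)

/-- Multiplication by `z` shifts the coefficients; the truncated `k - 1` at `k = 0` is harmless
because of the factor `k`. -/
theorem mul_egf {c : ℕ → ℂ} (h : GeomBdd c) (z : ℂ) :
    HasSum (fun k : ℕ => (k * c (k - 1)) * (z ^ k / k.factorial)) (z * egf c z) := by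
  rw [← hasSum_nat_add_iff' 1]
  simp only [Finset.range_one, Finset.sum_singleton, Nat.cast_zero, zero_mul, sub_zero,
    Nat.add_sub_cancel]
  refine ((h.hasSum z).mul_left z).congr_fun fun k => ?_
  have : ((k : ℂ) + 1) ≠ 0 := by exact_mod_cast Nat.succ_ne_zero k
  have : (k.factorial : ℂ) ≠ 0 := by exact_mod_cast k.factorial_ne_zero
  rw [Nat.factorial_succ]
  push_cast
  field_simp
  ring

/-- For `k ≥ 1 + ‖b‖` the norm is at least `1`, so only finitely many `k` matter. -/
theorem exists_pos_le_norm_add_natCast {b : ℂ} (hb : ∀ k : ℕ, b + k ≠ 0) :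
    ∃ δ : ℝ, 0 < δ ∧ ∀ k : ℕ, δ ≤ ‖b + k‖ := by
  have h : ∀ K : ℕ, ∃ δ : ℝ, 0 < δ ∧ δ ≤ 1 ∧ ∀ k < K, δ ≤ ‖b + k‖ := by
    intro K
    induction K with
    | zero => exact ⟨1, one_pos, le_rfl, by simp⟩
    | succ K ih =>
      obtain ⟨δ, h0, h1, h⟩ := ih
      refine ⟨min δ ‖b + K‖, lt_min h0 (norm_pos_iff.2 (hb K)), (min_le_left _ _).trans h1, ?_⟩
      intro k hk
      rcases Nat.lt_succ_iff_lt_or_eq.1 hk with hk | rfl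
      · exact (min_le_left _ _).trans (h k hk)
      · exact min_le_right _ _
  obtain ⟨K, hK⟩ := exists_nat_ge (1 + ‖b‖)
  obtain ⟨δ, h0, h1, h⟩ := h K
  refine ⟨δ, h0, fun k => ?_⟩
  by_cases hk : k < K
  · exact h k hk
  · have h2 : (K : ℝ) ≤ k := by exact_mod_cast not_lt.1 hk
    have h3 : (k : ℝ) ≤ ‖b + k‖ + ‖b‖ := by
      have := norm_sub_le (b + k) b
      rwa [add_sub_cancel_left, Complex.norm_natCast] at this
    linarith

/-! ### Kummer's function and its contiguous relations, by comparison of coefficients. -/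

/-- The coefficients `(a)_k / (b)_k` of Kummer's function. -/
noncomputable def kummerCoeff (a b : ℂ) (k : ℕ) : ℂ :=
  (ascPochhammer ℂ k).eval a / (ascPochhammer ℂ k).eval b

theorem kummerM_eq_egf (a b z : ℂ) : kummerM a b z = egf (kummerCoeff a b) z := rfl

theorem ascPochhammer_eval_succ_left (k : ℕ) (a : ℂ) :
    (ascPochhammer ℂ (k + 1)).eval a = a * (ascPochhammer ℂ k).eval (a + 1) := by
  simp [ascPochhammer_succ_left, Polynomial.eval_comp]

theorem ascPochhammer_eval_ne_zero {b : ℂ} (hb : ∀ k : ℕ, b + k ≠ 0) (k : ℕ) :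
    (ascPochhammer ℂ k).eval b ≠ 0 := by
  induction k with
  | zero => simp
  | succ k ih => rw [ascPochhammer_succ_eval]; exact mul_ne_zero ih (hb k)

theorem kummerCoeff_zero (a b : ℂ) : kummerCoeff a b 0 = 1 := by simp [kummerCoeff]

theorem kummerCoeff_succ (a b : ℂ) (k : ℕ) :
    kummerCoeff a b (k + 1) = kummerCoeff a b k * ((a + k) / (b + k)) := by
  simp only [kummerCoeff, ascPochhammer_succ_eval, div_eq_mul_inv, mul_inv]
  ring

theorem kummerCoeff_succ' (a b : ℂ) (k : ℕ) :
    kummerCoeff a b (k + 1) = a / b * kummerCoeff (a + 1) (b + 1) k := by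
  simp only [kummerCoeff, ascPochhammer_eval_succ_left, div_eq_mul_inv, mul_inv]
  ring

/-- Successive coefficients have quotient `1 + (a - b) / (b + k)`. The bound involves only `δ` and
`A`, hence is uniform for parameters near a given point. -/
theorem norm_kummerCoeff_le {a b : ℂ} {δ A : ℝ} (hδ : 0 < δ) (hb : ∀ k : ℕ, δ ≤ ‖b + k‖)
    (hA : ‖a - b‖ ≤ A) (k : ℕ) : ‖kummerCoeff a b k‖ ≤ 1 * (1 + A / δ) ^ k := by
  rw [one_mul]
  induction k with
  | zero => simp [kummerCoeff_zero]
  | succ k ih =>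
    have hA0 : 0 ≤ A := (norm_nonneg _).trans hA
    have hbk : 0 < ‖b + k‖ := hδ.trans_le (hb k)
    have h1 : (a + k) / (b + k) = 1 + (a - b) / (b + k) := by
      have := norm_pos_iff.1 hbk
      field_simp
      ring
    rw [kummerCoeff_succ, norm_mul, pow_succ]
    have h2 : ‖(a + k) / (b + k)‖ ≤ 1 + A / δ := by
      rw [h1]
      refine (norm_add_le _ _).trans ?_
      rw [norm_one, norm_div]
      gcongr
      exact hb k
    exact mul_le_mul ih h2 (norm_nonneg _) (by positivity)

theorem geomBdd_kummerCoeff (a : ℂ) {b : ℂ} (hb : ∀ k : ℕ, b + k ≠ 0) :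
    GeomBdd (kummerCoeff a b) := by
  obtain ⟨δ, hδ, h⟩ := exists_pos_le_norm_add_natCast hb
  exact ⟨1, 1 + ‖a - b‖ / δ, zero_le_one, by positivity, norm_kummerCoeff_le hδ h le_rfl⟩

theorem add_one_add_natCast_ne {b : ℂ} (hb : ∀ k : ℕ, b + k ≠ 0) (k : ℕ) : b + 1 + k ≠ 0 := by
  have := hb (k + 1)
  push_cast at this
  rwa [add_assoc, add_comm 1]

theorem egf_shift_kummerCoeff (a b z : ℂ) :
    egf (fun k => kummerCoeff a b (k + 1)) z = a / b * kummerM (a + 1) (b + 1) z := by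
  simp only [kummerCoeff_succ', kummerM_eq_egf, egf, mul_assoc, tsum_mul_left]

theorem hasDerivAt_kummerM (a : ℂ) {b : ℂ} (hb : ∀ k : ℕ, b + k ≠ 0) (z : ℂ) :
    HasDerivAt (kummerM a b) (a / b * kummerM (a + 1) (b + 1) z) z := by
  rw [← egf_shift_kummerCoeff]
  exact hasDerivAt_egf (geomBdd_kummerCoeff a hb) z

/-- The Euler operator `z d/dz` multiplies the `k`-th term by `k`. -/
theorem GeomBdd.hasSum_euler {c : ℕ → ℂ} (h : GeomBdd c) (z : ℂ) :
    HasSum (fun k : ℕ => (k * c k) * (z ^ k / k.factorial)) (z * egf (fun k => c (k + 1)) z) := by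
  refine (mul_egf h.shift z).congr_fun fun k => ?_
  cases k <;> simp

/-- The rule for `(z^(b-1) M(a,b,z))'`. -/
theorem kummerM_lower_right (a : ℂ) {b : ℂ} (hb : ∀ k : ℕ, b + k ≠ 0) (hb' : b - 1 ≠ 0) (z : ℂ) :
    z * (a / b * kummerM (a + 1) (b + 1) z) + (b - 1) * kummerM a b z
      = (b - 1) * kummerM a (b - 1) z := by
  have h := geomBdd_kummerCoeff a hb
  rw [← egf_shift_kummerCoeff, kummerM_eq_egf, kummerM_eq_egf]
  refine ((h.hasSum_euler z).add ((h.hasSum z).mul_left (b - 1))).unique ?_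
  have hb1 : ∀ k : ℕ, b - 1 + k ≠ 0 := by
    rintro (_ | k)
    · simpa using hb'
    · have := hb k
      push_cast
      rwa [show b - 1 + (k + 1 : ℂ) = b + k by ring]
  refine (((geomBdd_kummerCoeff a hb1).hasSum z).mul_left (b - 1)).congr_fun fun k => ?_
  have h1 := ascPochhammer_eval_ne_zero hb k
  have h2 := ascPochhammer_eval_ne_zero hb1 k
  -- Both sides are the rising factorial `(b - 1)_{k+1}`, split at its last and at its first factor.
  have h3 : (b - 1 + k) * (ascPochhammer ℂ k).eval (b - 1)
      = (b - 1) * (ascPochhammer ℂ k).eval b := by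
    have := ascPochhammer_eval_succ_left k (b - 1)
    rw [ascPochhammer_succ_eval, sub_add_cancel] at this
    rw [← this, mul_comm]
  have h4 : (b - 1 + k) * kummerCoeff a b k = (b - 1) * kummerCoeff a (b - 1) k := by
    unfold kummerCoeff
    field_simp
    linear_combination ((ascPochhammer ℂ k).eval a) * h3
  linear_combination (z ^ k / k.factorial : ℂ) * h4

/-- The rule for `(e^{-z} M(a,b,z))'`. -/
theorem kummerM_raise_right (a : ℂ) {b : ℂ} (hb : ∀ k : ℕ, b + k ≠ 0) (z : ℂ) :
    a / b * kummerM (a + 1) (b + 1) z - kummerM a b z = -((b - a) / b) * kummerM a (b + 1) z := by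
  have h := geomBdd_kummerCoeff a hb
  rw [← egf_shift_kummerCoeff, kummerM_eq_egf, kummerM_eq_egf]
  refine ((h.shift.hasSum z).sub (h.hasSum z)).unique ?_
  have hb1 := add_one_add_natCast_ne hb
  refine (((geomBdd_kummerCoeff a hb1).hasSum z).mul_left _).congr_fun fun k => ?_
  have h0 : b ≠ 0 := by simpa using hb 0
  have h1 := ascPochhammer_eval_ne_zero hb k
  have h2 := ascPochhammer_eval_ne_zero hb1 k
  have hk := hb k
  have h3 : (b + k) * (ascPochhammer ℂ k).eval b
      = b * (ascPochhammer ℂ k).eval (b + 1) := by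
    rw [← ascPochhammer_eval_succ_left, ascPochhammer_succ_eval, mul_comm]
  have h4 : kummerCoeff a b (k + 1) - kummerCoeff a b k
      = -((b - a) / b) * kummerCoeff a (b + 1) k := by
    rw [kummerCoeff_succ]
    unfold kummerCoeff
    field_simp
    linear_combination ((ascPochhammer ℂ k).eval a) * (b - a) * h3
  linear_combination (z ^ k / k.factorial : ℂ) * h4

/-- The rule for `(e^{-z} z^(b-1) M(a,b,z))'`. -/
theorem kummerM_lower_both (a : ℂ) {b : ℂ} (hb : ∀ k : ℕ, b + k ≠ 0) (hb' : b - 1 ≠ 0) (z : ℂ) :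
    z * (a / b * kummerM (a + 1) (b + 1) z) + (b - 1 - z) * kummerM a b z
      = (b - 1) * kummerM (a - 1) (b - 1) z := by
  have h := geomBdd_kummerCoeff a hb
  rw [← egf_shift_kummerCoeff, kummerM_eq_egf, kummerM_eq_egf, sub_mul, ← add_sub_assoc]
  refine (((h.hasSum_euler z).add ((h.hasSum z).mul_left (b - 1))).sub (mul_egf h z)).unique ?_
  have hb1 : ∀ k : ℕ, b - 1 + k ≠ 0 := by
    rintro (_ | k)
    · simpa using hb'
    · have := hb k
      push_cast
      rwa [show b - 1 + (k + 1 : ℂ) = b + k by ring]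
  refine (((geomBdd_kummerCoeff _ hb1).hasSum z).mul_left (b - 1)).congr_fun fun k => ?_
  have h4 : (b - 1 + k) * kummerCoeff a b k - k * kummerCoeff a b (k - 1)
      = (b - 1) * kummerCoeff (a - 1) (b - 1) k := by
    cases k with
    | zero => simp [kummerCoeff_zero]
    | succ k =>
      have hk := hb k
      have h5 := kummerCoeff_succ' (a - 1) (b - 1) k
      rw [sub_add_cancel, sub_add_cancel] at h5
      rw [h5, kummerCoeff_succ, Nat.add_sub_cancel]
      push_cast
      field_simp
      ring
  linear_combination (z ^ k / k.factorial : ℂ) * h4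

/-! ### Laguerre polynomials: the four first-order differentiation rules. -/

section

theorem ascPochhammer_eval_neg_natCast {n k : ℕ} (hk : k ≤ n) :
    (ascPochhammer ℂ k).eval (-(n : ℂ)) * (n - k).factorial = (-1) ^ k * n.factorial := by
  induction k with
  | zero => simp
  | succ k ih =>
    have h1 := ih (by omega)
    have h2 : n - k = (n - (k + 1)) + 1 := by omega
    have h3 : ((n - (k + 1) : ℕ) : ℂ) + 1 = n - k := by
      rw [← Nat.cast_sub (by omega), h2]
      push_cast
      rfl
    rw [h2, Nat.factorial_succ] at h1
    push_cast at h1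
    rw [h3] at h1
    rw [ascPochhammer_succ_eval]
    linear_combination -h1

theorem ascPochhammer_eval_eq_zero_of_lt {n k : ℕ} (hk : n < k) :
    (ascPochhammer ℂ k).eval (-(n : ℂ)) = 0 := by
  induction k, hk using Nat.le_induction with
  | base => simp [ascPochhammer_succ_eval]
  | succ k _ ih => simp [ascPochhammer_succ_eval, ih]

theorem ascPochhammer_eval_add (k m : ℕ) (a : ℂ) :
    (ascPochhammer ℂ (k + m)).eval a
      = (ascPochhammer ℂ k).eval a * (ascPochhammer ℂ m).eval (a + k) := by
  rw [← ascPochhammer_mul, Polynomial.eval_mul, Polynomial.eval_comp]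
  simp

theorem ofReal_ascPochhammer_eval (k : ℕ) (a : ℝ) :
    (((ascPochhammer ℝ k).eval a : ℝ) : ℂ) = (ascPochhammer ℂ k).eval (a : ℂ) := by
  induction k with
  | zero => simp
  | succ k ih => simp [ascPochhammer_succ_eval, ih]

/-- The Laguerre polynomial as a complex valued function. -/
noncomputable def laguerreC (n : ℕ) (a x : ℝ) : ℂ := ((laguerre n a x : ℝ) : ℂ)

/-- The Kummer series stops after degree `n` because `(-n)_k = 0` for `k > n`. All rules for
Laguerre polynomials below thereby follow from those for `kummerM`. -/
theorem laguerreC_eq_kummerM (n : ℕ) {a : ℝ} (ha : ∀ k : ℕ, (a : ℂ) + 1 + k ≠ 0) (x : ℝ) :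
    laguerreC n a x = (ascPochhammer ℂ n).eval ((a : ℂ) + 1) / n.factorial
      * kummerM (-n) (a + 1) x := by
  unfold laguerreC laguerre kummerM
  rw [tsum_eq_sum (s := Finset.range (n + 1)), Finset.mul_sum, Complex.ofReal_sum]
  · refine Finset.sum_congr rfl fun k hk => ?_
    have hk : k ≤ n := Nat.lt_succ_iff.1 (Finset.mem_range.1 hk)
    have h1 := ascPochhammer_eval_ne_zero ha k
    have h2 := ascPochhammer_eval_neg_natCast hk
    have h3 := ascPochhammer_eval_add k (n - k) ((a : ℂ) + 1)
    rw [Nat.add_sub_cancel' hk] at h3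
    have h4 : (n.factorial : ℂ) ≠ 0 := by exact_mod_cast n.factorial_ne_zero
    have h5 : ((n - k).factorial : ℂ) ≠ 0 := by exact_mod_cast (n - k).factorial_ne_zero
    have h6 : (k.factorial : ℂ) ≠ 0 := by exact_mod_cast k.factorial_ne_zero
    push_cast [ofReal_ascPochhammer_eval]
    rw [h3, show (a : ℂ) + k + 1 = a + 1 + k by ring]
    field_simp
    linear_combination (-(Polynomial.eval ((a : ℂ) + 1 + k) (ascPochhammer ℂ (n - k)) *
      (x : ℂ) ^ k)) * h2
  · intro k hk
    rw [ascPochhammer_eval_eq_zero_of_lt (by simpa using hk)]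
    simp

/-- No integer is equal to `a`. -/
def NonInt (a : ℝ) : Prop := ∀ k : ℤ, a ≠ k

theorem NonInt.add_int {a : ℝ} (h : NonInt a) (m : ℤ) : NonInt (a + m) := fun k hk =>
  h (k - m) (by push_cast; linarith)

theorem NonInt.add_one {a : ℝ} (h : NonInt a) : NonInt (a + 1) := by simpa using h.add_int 1

theorem NonInt.sub_one {a : ℝ} (h : NonInt a) : NonInt (a - 1) := by
  simpa [sub_eq_add_neg] using h.add_int (-1)

theorem NonInt.neg {a : ℝ} (h : NonInt a) : NonInt (-a) := fun k hk =>
  h (-k) (by push_cast; linarith)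

theorem NonInt.ne_intCast {a : ℝ} (h : NonInt a) (m : ℤ) : (a : ℂ) ≠ m := by
  exact_mod_cast h m

theorem NonInt.ne_zero {a : ℝ} (h : NonInt a) : (a : ℂ) ≠ 0 := by
  simpa using h.ne_intCast 0

theorem NonInt.add_one_add_natCast_ne {a : ℝ} (h : NonInt a) (k : ℕ) : (a : ℂ) + 1 + k ≠ 0 := by
  intro hk
  refine h.ne_intCast (-(k + 1)) ?_
  push_cast
  linear_combination hk

/-- The derivative of the Laguerre polynomial with parameter `a`. -/
noncomputable def laguerreDeriv (n : ℕ) (a x : ℝ) : ℂ :=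
  (ascPochhammer ℂ n).eval ((a : ℂ) + 1) / n.factorial
      * (-n / (a + 1) * kummerM (-n + 1) (a + 1 + 1) x)

variable {a : ℝ} (n : ℕ) (x : ℝ)

theorem hasDerivAt_laguerreC (ha : NonInt a) :
    HasDerivAt (laguerreC n a) (laguerreDeriv n a x) x := by
  have h := (hasDerivAt_kummerM (-n) ha.add_one_add_natCast_ne (x : ℂ)).comp_ofReal.const_mul
    ((ascPochhammer ℂ n).eval ((a : ℂ) + 1) / n.factorial)
  exact h.congr_of_eventuallyEq
    (Eventually.of_forall fun y => laguerreC_eq_kummerM n ha.add_one_add_natCast_ne y)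

theorem hasDerivAt_laguerreC_neg (ha : NonInt a) :
    HasDerivAt (fun x => laguerreC n a (-x)) (-laguerreDeriv n a (-x)) x := by
  have h := (hasDerivAt_laguerreC n (-x) ha).scomp x (hasDerivAt_neg x)
  rw [neg_one_smul] at h
  exact h

theorem factorial_succ_cast (n : ℕ) : ((n + 1).factorial : ℂ) = (n + 1) * n.factorial := by
  rw [Nat.factorial_succ]; push_cast; rfl

/-- This rule and the next three compute the derivatives of `L`, `e^{-x} L`, `x^a L` and `e^{-x} x^a
L` for `L = L_n^a`, with the exponential and the power divided out. These are the combinations that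
occur once a seed is divided by a seed of degree `0`. -/
theorem laguerreDeriv_succ (ha : NonInt a) :
    laguerreDeriv (n + 1) a x = -laguerreC n (a + 1) x := by
  have h0 := ha.add_one.ne_zero
  have h4 : (n.factorial : ℂ) ≠ 0 := by exact_mod_cast n.factorial_ne_zero
  have h5 : (n : ℂ) + 1 ≠ 0 := by exact_mod_cast n.succ_ne_zero
  rw [laguerreDeriv, laguerreC_eq_kummerM n ha.add_one.add_one_add_natCast_ne,
    ascPochhammer_eval_succ_left, factorial_succ_cast]
  push_cast at h0 ⊢
  rw [show -((n : ℂ) + 1) + 1 = -n by ring]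
  field_simp

theorem laguerreDeriv_sub (ha : NonInt a) :
    laguerreDeriv n a x - laguerreC n a x = -laguerreC n (a + 1) x := by
  have h0 := ha.add_one.ne_zero
  have h4 : (n.factorial : ℂ) ≠ 0 := by exact_mod_cast n.factorial_ne_zero
  have h6 := kummerM_raise_right (-n) ha.add_one_add_natCast_ne (x : ℂ)
  have h7 : (ascPochhammer ℂ n).eval ((a : ℂ) + 1) * (a + 1 + n)
      = (a + 1) * (ascPochhammer ℂ n).eval ((a : ℂ) + 1 + 1) := by
    rw [← ascPochhammer_eval_succ_left, ascPochhammer_succ_eval]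
  rw [laguerreDeriv, laguerreC_eq_kummerM n ha.add_one.add_one_add_natCast_ne,
    laguerreC_eq_kummerM n ha.add_one_add_natCast_ne, ← mul_sub, h6]
  push_cast at h0 ⊢
  field_simp
  linear_combination (-kummerM (-n) (a + 1 + 1) x) * h7

theorem mul_laguerreDeriv_add (ha : NonInt a) :
    x * laguerreDeriv n a x + a * laguerreC n a x = (n + a) * laguerreC n (a - 1) x := by
  have h4 : (n.factorial : ℂ) ≠ 0 := by exact_mod_cast n.factorial_ne_zero
  have h6 := kummerM_lower_right (-n) ha.add_one_add_natCast_ne (by simpa using ha.ne_zero) (x : ℂ)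
  have h7 : (ascPochhammer ℂ n).eval (a : ℂ) * (a + n)
      = a * (ascPochhammer ℂ n).eval ((a : ℂ) + 1) := by
    rw [← ascPochhammer_eval_succ_left, ascPochhammer_succ_eval]
  rw [laguerreDeriv, laguerreC_eq_kummerM n ha.sub_one.add_one_add_natCast_ne,
    laguerreC_eq_kummerM n ha.add_one_add_natCast_ne]
  push_cast
  rw [add_sub_cancel_right] at h6
  rw [sub_add_cancel]
  field_simp
  linear_combination (ascPochhammer ℂ n).eval ((a : ℂ) + 1) * h6
    - kummerM (-n) a x * h7

theorem mul_laguerreDeriv_add_sub (ha : NonInt a) :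
    x * laguerreDeriv n a x + (a - x) * laguerreC n a x
      = (n + 1) * laguerreC (n + 1) (a - 1) x := by
  have h4 : (n.factorial : ℂ) ≠ 0 := by exact_mod_cast n.factorial_ne_zero
  have h5 : (n : ℂ) + 1 ≠ 0 := by exact_mod_cast n.succ_ne_zero
  have h6 := kummerM_lower_both (-n) ha.add_one_add_natCast_ne (by simpa using ha.ne_zero) (x : ℂ)
  rw [laguerreDeriv, laguerreC_eq_kummerM _ ha.sub_one.add_one_add_natCast_ne,
    laguerreC_eq_kummerM n ha.add_one_add_natCast_ne, factorial_succ_cast]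
  push_cast
  rw [add_sub_cancel_right] at h6
  rw [sub_add_cancel, ascPochhammer_eval_succ_left, neg_add, ← sub_eq_add_neg]
  have h8 : (ascPochhammer ℂ n).eval ((a : ℂ) + 1) / n.factorial * (a * kummerM (-n - 1) a x)
      = (n + 1) * (a * (ascPochhammer ℂ n).eval ((a : ℂ) + 1) / ((n + 1) * n.factorial)
        * kummerM (-n - 1) a x) := by
    field_simp
  rw [← h8, ← h6]
  ring

/-! ### Differentiation of products with `e^{sx} x^p`. -/

/-- The function `e^{sx} x^p`. -/
noncomputable def expPow (s p x : ℝ) : ℂ := ((Real.exp (s * x) * x ^ p : ℝ) : ℂ)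

theorem expPow_mul_expPow {x : ℝ} (hx : 0 < x) (s p s' p' : ℝ) :
    expPow s p x * expPow s' p' x = expPow (s + s') (p + p') x := by
  rw [expPow, expPow, expPow, ← Complex.ofReal_mul, add_mul, Real.exp_add, Real.rpow_add hx]
  congr 1
  ring

theorem expPow_zero (x : ℝ) : expPow 0 0 x = 1 := by simp [expPow]

theorem expPow_ne_zero {x : ℝ} (hx : 0 < x) (s p : ℝ) : expPow s p x ≠ 0 := by
  have := Real.rpow_pos_of_pos hx p
  rw [expPow]
  exact_mod_cast (mul_pos (Real.exp_pos _) this).ne'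

theorem expPow_pow {x : ℝ} (hx : 0 < x) (s p : ℝ) (n : ℕ) :
    expPow s p x ^ n = expPow (n * s) (n * p) x := by
  induction n with
  | zero => simp [expPow_zero]
  | succ n ih =>
    rw [pow_succ, ih, expPow_mul_expPow hx]
    congr 1 <;> push_cast <;> ring

theorem contDiffAt_expPow {x : ℝ} (hx : 0 < x) (s p : ℝ) (k : ℕ) :
    ContDiffAt ℝ k (expPow s p) x := by
  have h : ContDiffAt ℝ k (fun x : ℝ => Real.exp (s * x) * x ^ p) x :=
    (contDiffAt_const.mul contDiffAt_id).exp.mul (Real.contDiffAt_rpow_const_of_ne hx.ne')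
  exact Complex.ofRealCLM.contDiff.contDiffAt.comp x h

theorem hasDerivAt_expPow_mul {x : ℝ} (hx : 0 < x) (s p : ℝ) {g : ℝ → ℂ} {g' : ℂ}
    (hg : HasDerivAt g g' x) :
    HasDerivAt (fun x => expPow s p x * g x)
      (expPow s (p - 1) x * (s * x * g x + p * g x + x * g')) x := by
  have h1 : HasDerivAt (fun x : ℝ => Real.exp (s * x) * x ^ p)
      (Real.exp (s * x) * s * x ^ p + Real.exp (s * x) * (p * x ^ (p - 1))) x := by
    have h0 : HasDerivAt (fun x : ℝ => s * x) s x := by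
      simpa using (hasDerivAt_id x).const_mul s
    exact (h0.exp.mul (Real.hasDerivAt_rpow_const (p := p) (Or.inl hx.ne'))).congr_deriv rfl
  have h2 : x ^ p = x * x ^ (p - 1) := by
    rw [mul_comm, ← Real.rpow_add_one hx.ne', sub_add_cancel]
  refine (h1.ofReal_comp.mul hg).congr_deriv ?_
  simp only [expPow, h2]
  push_cast
  ring

theorem hasDerivAt_expPow_mul_of_eq {x : ℝ} (hx : 0 < x) {s p : ℝ} {g : ℝ → ℂ} {g' c h : ℂ}
    (hg : HasDerivAt g g' x) (hc : s * x * g x + p * g x + x * g' = c * h) :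
    HasDerivAt (fun x => expPow s p x * g x) (c * (expPow s (p - 1) x * h)) x :=
  (hasDerivAt_expPow_mul hx s p hg).congr_deriv (by rw [hc]; ring)

/-- For `p = 0` every term of the general rule contains a factor `x`, which restores the lost power;
the exponent therefore does not drop. -/
theorem hasDerivAt_expPow_zero_mul_of_eq {x : ℝ} (hx : 0 < x) {s : ℝ} {g : ℝ → ℂ} {g' c h : ℂ}
    (hg : HasDerivAt g g' x) (hc : s * g x + g' = c * h) :
    HasDerivAt (fun x => expPow s 0 x * g x) (c * (expPow s 0 x * h)) x := by
  refine (hasDerivAt_expPow_mul hx s 0 hg).congr_deriv ?_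
  have h2 : expPow s 0 x = expPow s (0 - 1) x * x := by
    rw [expPow, expPow, Real.rpow_sub_one hx.ne']
    push_cast
    have : (x : ℂ) ≠ 0 := by exact_mod_cast hx.ne'
    field_simp
  rw [h2]
  push_cast
  linear_combination (expPow s (0 - 1) x) * x * hc

end

/-! ### Labels, and the derivative tables of the four moves. -/

section

/-- Labels of the four kinds of seed functions and of the second solution. -/
inductive Label
  | one (n : ℕ)
  | two (n : ℕ)
  | three (n : ℕ)
  | four (n : ℕ)
  | sol

/-- The function with a given label. -/
noncomputable def Label.fn (α : ℝ) (lam : ℂ) : Label → ℝ → ℂ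
  | one n => seed1 α n
  | two n => seed2 α n
  | three n => seed3 α n
  | four n => seed4 α n
  | sol => hTilde α lam

theorem seed1_eq (α : ℝ) (n : ℕ) (y : ℝ) : seed1 α n y = expPow 0 0 y * laguerreC n α y := by
  simp [seed1, expPow, laguerreC]

theorem seed2_eq (α : ℝ) (n : ℕ) (y : ℝ) : seed2 α n y = expPow 1 0 y * laguerreC n α (-y) := by
  simp [seed2, expPow, laguerreC]

theorem seed3_eq (α : ℝ) (n : ℕ) (y : ℝ) :
    seed3 α n y = expPow 0 (-α) y * laguerreC n (-α) y := by
  simp [seed3, expPow, laguerreC]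

theorem seed4_eq (α : ℝ) (n : ℕ) (y : ℝ) :
    seed4 α n y = expPow 1 (-α) y * laguerreC n (-α) (-y) := by
  simp [seed4, expPow, laguerreC]

theorem hTilde_eq (α : ℝ) (lam : ℂ) (y : ℝ) :
    hTilde α lam y = expPow 0 (-α) y * kummerM (-lam - α) (1 - α) y := by
  simp [hTilde, expPow]

theorem contDiff_laguerreC (n : ℕ) (a : ℝ) (k : ℕ) : ContDiff ℝ k (laguerreC n a) := by
  have h : ContDiff ℝ k (fun x => laguerre n a x) := by
    simp only [laguerre]
    fun_prop
  exact Complex.ofRealCLM.contDiff.comp h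

theorem contDiff_kummerM (a : ℂ) {b : ℂ} (hb : ∀ k : ℕ, b + k ≠ 0) (k : ℕ) :
    ContDiff ℝ k (fun x : ℝ => kummerM a b x) :=
  contDiff_egf k (geomBdd_kummerCoeff a hb)

theorem Label.contDiffAt_fn {α : ℝ} (lam : ℂ) (hα : ∀ k : ℕ, 1 - (α : ℂ) + k ≠ 0) (i : Label)
    {x : ℝ} (hx : 0 < x) (k : ℕ) : ContDiffAt ℝ k (i.fn α lam) x := by
  cases i with
  | one n =>
    rw [Label.fn, show seed1 α n = _ from funext (seed1_eq α n)]
    exact (contDiffAt_expPow hx _ _ k).mul (contDiff_laguerreC n α k).contDiffAt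
  | two n =>
    rw [Label.fn, show seed2 α n = _ from funext (seed2_eq α n)]
    exact (contDiffAt_expPow hx _ _ k).mul
      ((contDiff_laguerreC n α k).comp contDiff_neg).contDiffAt
  | three n =>
    rw [Label.fn, show seed3 α n = _ from funext (seed3_eq α n)]
    exact (contDiffAt_expPow hx _ _ k).mul (contDiff_laguerreC n _ k).contDiffAt
  | four n =>
    rw [Label.fn, show seed4 α n = _ from funext (seed4_eq α n)]
    exact (contDiffAt_expPow hx _ _ k).mul
      ((contDiff_laguerreC n _ k).comp contDiff_neg).contDiffAt
  | sol =>
    rw [Label.fn, show hTilde α lam = _ from funext (hTilde_eq α lam)]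
    exact (contDiffAt_expPow hx _ _ k).mul (contDiff_kummerM _ hα k).contDiffAt

theorem NonInt.one_sub_add_natCast_ne {α : ℝ} (h : NonInt α) (k : ℕ) : 1 - (α : ℂ) + k ≠ 0 := by
  have := h.neg.add_one_add_natCast_ne k
  push_cast at this
  rwa [sub_eq_add_neg, add_comm (1 : ℂ)]

section Tables

variable {x : ℝ} {s p s' p' vs vp ws wp : ℝ} {F G g h : ℝ → ℂ} {g' c : ℂ}

/-- Serves one entry of the tables: `F` is a function at the old parameters, `G` its image at the
new ones, and only the identity `hc` between Laguerre or Kummer factors remains to be checked. The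
variant after it treats the case in which the powers of `x` cancel. -/
theorem hasDerivAt_expPow_mul_fn (hx : 0 < x) (hg : HasDerivAt g g' x)
    (hF : ∀ y, F y = expPow s p y * g y) (hG : ∀ y, G y = expPow s' p' y * h y)
    (hs : vs + s = ws + s') (hp : vp + p - 1 = wp + p')
    (hc : ((vs + s : ℝ) : ℂ) * x * g x + ((vp + p : ℝ) : ℂ) * g x + x * g' = c * h x) :
    HasDerivAt (fun y => expPow vs vp y * F y) (c * (expPow ws wp x * G x)) x := by
  have H := hasDerivAt_expPow_mul_of_eq hx hg hc
  rw [hp, hs, ← expPow_mul_expPow hx, mul_assoc, ← hG] at H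
  refine H.congr_of_eventuallyEq ((lt_mem_nhds hx).mono fun y hy => ?_)
  change expPow vs vp y * F y = _
  rw [hF, ← mul_assoc, expPow_mul_expPow hy, hs]

theorem hasDerivAt_expPow_mul_fn_of_eq_zero (hx : 0 < x) (hg : HasDerivAt g g' x)
    (hF : ∀ y, F y = expPow s p y * g y) (hG : ∀ y, G y = expPow s' p' y * h y)
    (hs : vs + s = ws + s') (hp : vp + p = 0) (hp' : wp + p' = 0)
    (hc : ((vs + s : ℝ) : ℂ) * g x + g' = c * h x) :
    HasDerivAt (fun y => expPow vs vp y * F y) (c * (expPow ws wp x * G x)) x := by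
  have H := hasDerivAt_expPow_zero_mul_of_eq hx hg hc
  rw [← hp', hs, ← expPow_mul_expPow hx, mul_assoc, ← hG] at H
  refine H.congr_of_eventuallyEq ((lt_mem_nhds hx).mono fun y hy => ?_)
  change expPow vs vp y * F y = _
  rw [hF, ← mul_assoc, expPow_mul_expPow hy, hs, hp, hp']

end Tables

/-- The action on the labels of a derivative that shifts `M₁` downwards, and the factors. -/
def Label.downOne : Label → Label
  | one n => one (n - 1)
  | two n => two n
  | three n => three n
  | four n => four (n + 1)
  | sol => sol

/-- The factors that accompany `Label.downOne`. -/
noncomputable def Label.downOneCoeff (α : ℝ) : Label → ℂ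
  | one _ => -1
  | two _ => 1
  | three n => n - α
  | four n => n + 1
  | sol => -α

/-- The action on the labels of a derivative that shifts `M₁` upwards. -/
def Label.upOne : Label → Label
  | one n => one (n + 1)
  | two n => two n
  | three n => three n
  | four n => four (n - 1)
  | sol => sol

/-- The factors that accompany `Label.upOne`. -/
noncomputable def Label.upOneCoeff (α : ℝ) (lam : ℂ) : Label → ℂ
  | one n => n + 1
  | two n => n + α + 1
  | three _ => -1
  | four _ => 1
  | sol => lam / α

/-- The action on the labels of a derivative that shifts `M₂` downwards. -/
def Label.downTwo : Label → Label
  | one n => one n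
  | two n => two (n - 1)
  | three n => three (n + 1)
  | four n => four n
  | sol => sol

/-- The factors that accompany `Label.downTwo`. -/
noncomputable def Label.downTwoCoeff (α : ℝ) : Label → ℂ
  | one _ => -1
  | two _ => 1
  | three n => n + 1
  | four n => n - α
  | sol => -α

/-- The action on the labels of a derivative that shifts `M₂` upwards. -/
def Label.upTwo : Label → Label
  | one n => one n
  | two n => two (n + 1)
  | three n => three (n - 1)
  | four n => four n
  | sol => sol

/-- The factors that accompany `Label.upTwo`. -/
noncomputable def Label.upTwoCoeff (α : ℝ) (lam : ℂ) : Label → ℂ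
  | one n => n + α + 1
  | two n => n + 1
  | three _ => -1
  | four _ => 1
  | sol => (lam + α + 1) / α

variable {α : ℝ} (lam : ℂ) {x : ℝ}

/-- Here `v = 1` is the reciprocal of `L_0^α`. The excluded label is that of this seed, whose
derivative is `0` and for which `n - 1` would be truncated. -/
theorem hasDerivAt_downOne (hα : NonInt α) (hx : 0 < x) :
    ∀ i : Label, i ≠ .one 0 → HasDerivAt (fun y => expPow 0 0 y * i.fn α lam y)
      (i.downOneCoeff α * (expPow 0 0 x * i.downOne.fn (α + 1) (lam - 1) x)) x
  | .one 0, h => absurd rfl h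
  | .one (n + 1), _ =>
    hasDerivAt_expPow_mul_fn_of_eq_zero hx (hasDerivAt_laguerreC _ _ hα) (seed1_eq _ _)
      (seed1_eq _ _) (by ring) (by ring) (by ring) (by
        rw [laguerreDeriv_succ _ _ hα]; simp [Label.downOneCoeff])
  | .two n, _ =>
    hasDerivAt_expPow_mul_fn_of_eq_zero hx (hasDerivAt_laguerreC_neg _ _ hα) (seed2_eq _ _)
      (seed2_eq _ _) (by ring) (by ring) (by ring) (by
        have := laguerreDeriv_sub n (-x) hα
        push_cast [Label.downOneCoeff]
        linear_combination -this)
  | .three n, _ =>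
    hasDerivAt_expPow_mul_fn hx (hasDerivAt_laguerreC _ _ hα.neg) (seed3_eq _ _)
      (seed3_eq _ _) (by ring) (by ring) (by
        have := mul_laguerreDeriv_add n x hα.neg
        rw [← neg_add'] at this
        push_cast [Label.downOneCoeff] at this ⊢
        linear_combination this)
  | .four n, _ =>
    hasDerivAt_expPow_mul_fn hx (hasDerivAt_laguerreC_neg _ _ hα.neg) (seed4_eq _ _)
      (seed4_eq _ _) (by ring) (by ring) (by
        have := mul_laguerreDeriv_add_sub n (-x) hα.neg
        rw [← neg_add'] at this
        push_cast [Label.downOneCoeff] at this ⊢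
        linear_combination this)
  | .sol, _ =>
    hasDerivAt_expPow_mul_fn hx
      (hasDerivAt_kummerM _ hα.one_sub_add_natCast_ne (x : ℂ)).comp_ofReal (hTilde_eq _ _)
      (hTilde_eq _ _) (by ring) (by ring) (by
        have := kummerM_lower_right (-lam - α) hα.one_sub_add_natCast_ne
          (by simpa using hα.ne_zero) (x : ℂ)
        push_cast [Label.downOneCoeff] at this ⊢
        rw [show -(lam - 1) - (α + 1 : ℂ) = -lam - α by ring,
          show 1 - (α + 1 : ℂ) = 1 - α - 1 by ring]
        linear_combination this)

/-- Here `v = e^{-y} y^{α+1}` is the reciprocal of the fourth seed of degree `0` at parameter `α +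
1`; the move runs from `(α + 1, λ - 1)` to `(α, λ)`. -/
theorem hasDerivAt_upOne (hα : NonInt α) (hx : 0 < x) :
    ∀ i : Label, i ≠ .four 0 →
      HasDerivAt (fun y => expPow (-1) (α + 1) y * i.fn (α + 1) (lam - 1) y)
      (i.upOneCoeff α lam * (expPow (-1) α x * i.upOne.fn α lam x)) x
  | .one n, _ =>
    hasDerivAt_expPow_mul_fn hx (hasDerivAt_laguerreC _ _ hα.add_one) (seed1_eq _ _)
      (seed1_eq _ _) (by ring) (by ring) (by
        have := mul_laguerreDeriv_add_sub n x hα.add_one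
        rw [add_sub_cancel_right] at this
        push_cast [Label.upOneCoeff] at this ⊢
        linear_combination this)
  | .two n, _ =>
    hasDerivAt_expPow_mul_fn hx (hasDerivAt_laguerreC_neg _ _ hα.add_one) (seed2_eq _ _)
      (seed2_eq _ _) (by ring) (by ring) (by
        have := mul_laguerreDeriv_add n (-x) hα.add_one
        rw [add_sub_cancel_right] at this
        push_cast [Label.upOneCoeff] at this ⊢
        linear_combination this)
  | .three n, _ =>
    hasDerivAt_expPow_mul_fn_of_eq_zero hx (hasDerivAt_laguerreC _ _ hα.add_one.neg)
      (seed3_eq _ _) (seed3_eq _ _) (by ring) (by ring) (by ring) (by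
        have := laguerreDeriv_sub n x hα.add_one.neg
        rw [show -(α + 1) + 1 = -α by ring] at this
        push_cast [Label.upOneCoeff]
        linear_combination this)
  | .four 0, h => absurd rfl h
  | .four (n + 1), _ =>
    hasDerivAt_expPow_mul_fn_of_eq_zero hx (hasDerivAt_laguerreC_neg _ _ hα.add_one.neg)
      (seed4_eq _ _) (seed4_eq _ _) (by ring) (by ring) (by ring) (by
        rw [laguerreDeriv_succ _ _ hα.add_one.neg, show -(α + 1) + 1 = -α by ring]
        simp [Label.upOneCoeff])
  | .sol, _ =>
    hasDerivAt_expPow_mul_fn_of_eq_zero hx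
      (hasDerivAt_kummerM _ hα.add_one.one_sub_add_natCast_ne (x : ℂ)).comp_ofReal
      (hTilde_eq _ _) (hTilde_eq _ _) (by ring) (by ring) (by ring) (by
        have := kummerM_raise_right (-lam - α) hα.add_one.one_sub_add_natCast_ne (x : ℂ)
        have h0 := hα.ne_zero
        push_cast [Label.upOneCoeff] at this ⊢
        rw [show -(lam - 1) - (α + 1 : ℂ) = -lam - α by ring]
        rw [show 1 - (α + 1 : ℂ) + 1 = 1 - α by ring] at *
        rw [show (1 - (α + 1) : ℂ) = -α by ring] at *
        rw [show lam / α = -((-α - (-lam - α)) / -α : ℂ) by field_simp; ring]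
        linear_combination this)

/-- Here `v = e^{-y}` is the reciprocal of the second seed of degree `0`; `λ` is unchanged. -/
theorem hasDerivAt_downTwo (hα : NonInt α) (hx : 0 < x) :
    ∀ i : Label, i ≠ .two 0 → HasDerivAt (fun y => expPow (-1) 0 y * i.fn α lam y)
      (i.downTwoCoeff α * (expPow (-1) 0 x * i.downTwo.fn (α + 1) lam x)) x
  | .one n, _ =>
    hasDerivAt_expPow_mul_fn_of_eq_zero hx (hasDerivAt_laguerreC _ _ hα) (seed1_eq _ _)
      (seed1_eq _ _) (by ring) (by ring) (by ring) (by
        have := laguerreDeriv_sub n x hα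
        push_cast [Label.downTwoCoeff]
        linear_combination this)
  | .two 0, h => absurd rfl h
  | .two (n + 1), _ =>
    hasDerivAt_expPow_mul_fn_of_eq_zero hx (hasDerivAt_laguerreC_neg _ _ hα) (seed2_eq _ _)
      (seed2_eq _ _) (by ring) (by ring) (by ring) (by
        rw [laguerreDeriv_succ _ _ hα]; simp [Label.downTwoCoeff])
  | .three n, _ =>
    hasDerivAt_expPow_mul_fn hx (hasDerivAt_laguerreC _ _ hα.neg) (seed3_eq _ _)
      (seed3_eq _ _) (by ring) (by ring) (by
        have := mul_laguerreDeriv_add_sub n x hα.neg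
        rw [← neg_add'] at this
        push_cast [Label.downTwoCoeff] at this ⊢
        linear_combination this)
  | .four n, _ =>
    hasDerivAt_expPow_mul_fn hx (hasDerivAt_laguerreC_neg _ _ hα.neg) (seed4_eq _ _)
      (seed4_eq _ _) (by ring) (by ring) (by
        have := mul_laguerreDeriv_add n (-x) hα.neg
        rw [← neg_add'] at this
        push_cast [Label.downTwoCoeff] at this ⊢
        linear_combination this)
  | .sol, _ =>
    hasDerivAt_expPow_mul_fn hx
      (hasDerivAt_kummerM _ hα.one_sub_add_natCast_ne (x : ℂ)).comp_ofReal (hTilde_eq _ _)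
      (hTilde_eq _ _) (by ring) (by ring) (by
        have := kummerM_lower_both (-lam - α) hα.one_sub_add_natCast_ne
          (by simpa using hα.ne_zero) (x : ℂ)
        push_cast [Label.downTwoCoeff] at this ⊢
        rw [show -lam - (α + 1 : ℂ) = -lam - α - 1 by ring,
          show 1 - (α + 1 : ℂ) = 1 - α - 1 by ring]
        linear_combination this)

/-- Here `v = y^{α+1}` is the reciprocal of the third seed of degree `0` at parameter `α + 1`. -/
theorem hasDerivAt_upTwo (hα : NonInt α) (hx : 0 < x) :
    ∀ i : Label, i ≠ .three 0 →
      HasDerivAt (fun y => expPow 0 (α + 1) y * i.fn (α + 1) lam y)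
      (i.upTwoCoeff α lam * (expPow 0 α x * i.upTwo.fn α lam x)) x
  | .one n, _ =>
    hasDerivAt_expPow_mul_fn hx (hasDerivAt_laguerreC _ _ hα.add_one) (seed1_eq _ _)
      (seed1_eq _ _) (by ring) (by ring) (by
        have := mul_laguerreDeriv_add n x hα.add_one
        rw [add_sub_cancel_right] at this
        push_cast [Label.upTwoCoeff] at this ⊢
        linear_combination this)
  | .two n, _ =>
    hasDerivAt_expPow_mul_fn hx (hasDerivAt_laguerreC_neg _ _ hα.add_one) (seed2_eq _ _)
      (seed2_eq _ _) (by ring) (by ring) (by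
        have := mul_laguerreDeriv_add_sub n (-x) hα.add_one
        rw [add_sub_cancel_right] at this
        push_cast [Label.upTwoCoeff] at this ⊢
        linear_combination this)
  | .three 0, h => absurd rfl h
  | .three (n + 1), _ =>
    hasDerivAt_expPow_mul_fn_of_eq_zero hx (hasDerivAt_laguerreC _ _ hα.add_one.neg)
      (seed3_eq _ _) (seed3_eq _ _) (by ring) (by ring) (by ring) (by
        rw [laguerreDeriv_succ _ _ hα.add_one.neg, show -(α + 1) + 1 = -α by ring]
        simp [Label.upTwoCoeff])
  | .four n, _ =>
    hasDerivAt_expPow_mul_fn_of_eq_zero hx (hasDerivAt_laguerreC_neg _ _ hα.add_one.neg)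
      (seed4_eq _ _) (seed4_eq _ _) (by ring) (by ring) (by ring) (by
        have := laguerreDeriv_sub n (-x) hα.add_one.neg
        rw [show -(α + 1) + 1 = -α by ring] at this
        push_cast [Label.upTwoCoeff]
        linear_combination -this)
  | .sol, _ =>
    hasDerivAt_expPow_mul_fn_of_eq_zero hx
      (hasDerivAt_kummerM _ hα.add_one.one_sub_add_natCast_ne (x : ℂ)).comp_ofReal
      (hTilde_eq _ _) (hTilde_eq _ _) (by ring) (by ring) (by ring) (by
        have h0 := hα.ne_zero
        push_cast [Label.upTwoCoeff]
        rw [show -lam - (α + 1 : ℂ) + 1 = -lam - α by ring,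
          show (1 - (α + 1) : ℂ) + 1 = 1 - α by ring,
          show (1 - (α + 1) : ℂ) = -α by ring]
        field_simp
        ring)

end

/-! ### One-box moves for `Ω` with degrees given by finite sets. -/

/-- The labels that belong to four finite sets of degrees, followed by the second solution. -/
noncomputable def labelList (A B C D : Finset ℕ) : List Label :=
  (A.sort (· ≥ ·)).map .one ++ (B.sort (· ≥ ·)).map .two ++ (C.sort (· ≥ ·)).map .three ++
    (D.sort (· ≥ ·)).map .four ++ [.sol]

theorem coe_labelList (A B C D : Finset ℕ) : (labelList A B C D : Multiset Label) =
    A.val.map .one + B.val.map .two + C.val.map .three + D.val.map .four + {.sol} := by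
  simp only [labelList, ← Multiset.coe_add, ← Multiset.map_coe, Finset.sort_eq,
    Multiset.coe_singleton]

theorem length_labelList (A B C D : Finset ℕ) :
    (labelList A B C D).length = A.card + B.card + C.card + D.card + 1 := by
  simp [labelList]
  ring

theorem prod_map_labelList (A B C D : Finset ℕ) (c : Label → ℂ) :
    ((labelList A B C D).map c).prod = (∏ n ∈ A, c (.one n)) * (∏ n ∈ B, c (.two n)) *
      (∏ n ∈ C, c (.three n)) * (∏ n ∈ D, c (.four n)) * c .sol := by
  rw [← Multiset.prod_coe, ← Multiset.map_coe, coe_labelList]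
  simp only [Multiset.map_add, Multiset.map_map, Multiset.prod_add, Multiset.map_singleton,
    Multiset.prod_singleton]
  rfl

/-- The functions `Ω`, with the degrees of the seed functions given by finite sets. -/
noncomputable def omegaFinset (A B C D : Finset ℕ) (α : ℝ) (lam : ℂ) (x : ℝ) : ℂ :=
  expPow (-(B.card + D.card)) ((α + A.card + B.card) * (C.card + D.card + 1)) x *
    wronskian ((labelList A B C D).map (Label.fn α lam)) x

theorem omegaSeq_eq_omegaFinset (A B C D : Finset ℕ) (α : ℝ) (lam : ℂ) (x : ℝ) :
    omegaSeq (A.sort (· ≥ ·)) (B.sort (· ≥ ·)) (C.sort (· ≥ ·)) (D.sort (· ≥ ·)) α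
      (hTilde α lam) x = omegaFinset A B C D α lam x := by
  rw [omegaSeq, omegaFinset, expPow, labelList]
  simp only [List.map_append, List.map_map, List.map_cons, List.map_nil, Finset.length_sort]
  push_cast
  rfl

/-- Common template of the four moves: `i₀` is the seed divided out, `K` the other labels, `σ` their
images. The last two hypotheses balance the exponents of `e^x` and of `x` in the prefactors. The
sign collects the two reorderings and is fixed before the parameters. -/
theorem exists_omegaFinset_eq {A B C D A' B' C' D' : Finset ℕ} {K : List Label} {i₀ : Label}
    {σ : Label → Label} (h₁ : (labelList A B C D).Perm (i₀ :: K))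
    (h₂ : (K.map σ).Perm (labelList A' B' C' D')) :
    ∃ d : ℕ, ∀ {α α' : ℝ} {lam lam' : ℂ} {c : Label → ℂ} {vs vp ws wp x : ℝ},
      NonInt α → NonInt α' → 0 < x →
      (∀ y, 0 < y → expPow vs vp y * i₀.fn α lam y = 1) →
      (∀ i ∈ K, ∀ y, 0 < y → HasDerivAt (fun y => expPow vs vp y * i.fn α lam y)
        (c i * (expPow ws wp y * (σ i).fn α' lam' y)) y) →
      (-(B.card + D.card) + K.length * ws : ℝ) = -(B'.card + D'.card) + (K.length + 1) * vs →
      ((α + A.card + B.card) * (C.card + D.card + 1) + K.length * wp : ℝ) =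
        (α' + A'.card + B'.card) * (C'.card + D'.card + 1) + (K.length + 1) * vp →
      omegaFinset A B C D α lam x
        = (-1) ^ d * (K.map c).prod * omegaFinset A' B' C' D' α' lam' x := by
  obtain ⟨d₁, hd₁⟩ := wronskian_perm h₁
  obtain ⟨d₂, hd₂⟩ := wronskian_perm h₂
  refine ⟨d₁ + d₂, fun {α α' lam lam' c vs vp ws wp x} hα hα' hx h0 h hs hp => ?_⟩
  have key := wronskian_cons_eq hx (contDiffAt_expPow hx vs vp) (contDiffAt_expPow hx ws wp)
    (fun i => Label.contDiffAt_fn lam hα.one_sub_add_natCast_ne i hx)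
    (fun i => Label.contDiffAt_fn lam' hα'.one_sub_add_natCast_ne i hx) h0 h
  have hpre : expPow (-(B.card + D.card)) ((α + A.card + B.card) * (C.card + D.card + 1)) x *
      expPow ws wp x ^ K.length =
      expPow (-(B'.card + D'.card)) ((α' + A'.card + B'.card) * (C'.card + D'.card + 1)) x *
      expPow vs vp x ^ (K.length + 1) := by
    rw [expPow_pow hx, expPow_pow hx, expPow_mul_expPow hx, expPow_mul_expPow hx]
    push_cast
    rw [hs, hp]
  have hne : expPow ws wp x ^ K.length ≠ 0 := pow_ne_zero _ (expPow_ne_zero hx _ _)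
  rw [hd₂] at key
  rw [omegaFinset, omegaFinset, hd₁, pow_add]
  refine mul_right_cancel₀ hne ?_
  linear_combination (-1) ^ d₁ * wronskian ((i₀ :: K).map (Label.fn α lam)) x * hpre +
    (-1) ^ d₁ * expPow (-(B'.card + D'.card))
      ((α' + A'.card + B'.card) * (C'.card + D'.card + 1)) x * key

/-- The product `D₃`, with the degrees given by finite sets. -/
noncomputable def crossProd (A B C D : Finset ℕ) (α : ℝ) : ℂ :=
  (∏ n ∈ A, ∏ m ∈ C, ((n : ℂ) + α - m)) * (∏ n ∈ B, ∏ m ∈ D, ((n : ℂ) + α - m)) *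
    (∏ n ∈ A, ∏ m ∈ D, ((n : ℂ) + m + 1)) * (∏ n ∈ B, ∏ m ∈ C, ((n : ℂ) + m + 1))

theorem crossProd_swap (A B C D : Finset ℕ) (α : ℝ) :
    crossProd A B C D α = crossProd B A D C α := by
  simp only [crossProd]
  ring

theorem crossProd_ne_zero (A B C D : Finset ℕ) {α : ℝ} (hα : NonInt α) :
    crossProd A B C D α ≠ 0 := by
  have h1 : ∀ n m : ℕ, (n : ℂ) + α - m ≠ 0 := fun n m h =>
    hα.ne_intCast (m - n) (by push_cast; linear_combination h)
  have h2 : ∀ n m : ℕ, (n : ℂ) + m + 1 ≠ 0 := fun n m => by exact_mod_cast (n + m).succ_ne_zero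
  simp [crossProd, Finset.prod_ne_zero_iff, h1, h2]

/-- The translation of a set of degrees by one. -/
def succMap (A : Finset ℕ) : Finset ℕ := A.map ⟨Nat.succ, Nat.succ_injective⟩

theorem card_succMap (A : Finset ℕ) : (succMap A).card = A.card := Finset.card_map _

theorem val_map_succMap {β : Type*} (A : Finset ℕ) (f : ℕ → β) :
    (succMap A).val.map f = A.val.map fun n => f (n + 1) := by
  simp [succMap, Finset.map_val]

theorem prod_succMap (A : Finset ℕ) (f : ℕ → ℂ) :
    ∏ n ∈ succMap A, f n = ∏ n ∈ A, f (n + 1) := by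
  simp [succMap]

theorem val_map_of_zero_mem {β : Type*} {A A' : Finset ℕ} (h0 : 0 ∈ A)
    (h : A.erase 0 = succMap A') (f : ℕ → β) :
    A.val.map f = f 0 ::ₘ (succMap A').val.map f := by
  rw [← h, ← Multiset.map_cons, Finset.erase_val, Multiset.cons_erase h0]

theorem prod_of_zero_mem {A A' : Finset ℕ} (h0 : 0 ∈ A)
    (h : A.erase 0 = succMap A') (f : ℕ → ℂ) :
    ∏ n ∈ A, f n = f 0 * ∏ n ∈ A', f (n + 1) := by
  rw [← Finset.mul_prod_erase A f h0, h, prod_succMap]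

theorem card_of_zero_mem {A A' : Finset ℕ} (h0 : 0 ∈ A) (h : A.erase 0 = succMap A') :
    A.card = A'.card + 1 := by
  rw [← Finset.card_erase_add_one h0, h, card_succMap]

/-- The differences `n + α - m` and sums `n + m + 1` are invariant under the shift of degrees
together with `α ↦ α + 1`. Only the factors with `n = 0` split off, and up to sign they are the
coefficients of the third and fourth seeds in `Label.downOneCoeff`. -/
theorem crossProd_down {A A' : Finset ℕ} (h0 : 0 ∈ A) (h : A.erase 0 = succMap A')
    (B C D : Finset ℕ) (α : ℝ) : crossProd A B C D α =
      (∏ m ∈ C, ((α : ℂ) - m)) * (∏ m ∈ D, ((m : ℂ) + 1)) *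
        crossProd A' B C (succMap D) (α + 1) := by
  simp only [crossProd, prod_of_zero_mem h0 h, prod_succMap]
  push_cast
  simp only [zero_add]
  simp only [add_right_comm _ (1 : ℂ), add_sub_add_right_eq_sub, ← add_assoc]
  ring

/-- The same invariance; the factors split off belong to the new degree `0` in `D'` and are the
coefficients of the first and second seeds in `Label.upOneCoeff`. -/
theorem crossProd_up {D D' : Finset ℕ} (h0 : 0 ∈ D') (h : D'.erase 0 = succMap D)
    (A B C : Finset ℕ) (α : ℝ) : crossProd A B C D' (α + 1) =
      (∏ m ∈ A, ((m : ℂ) + 1)) * (∏ m ∈ B, ((m : ℂ) + α + 1)) *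
        crossProd (succMap A) B C D α := by
  simp only [crossProd, prod_of_zero_mem h0 h, prod_succMap, Finset.prod_mul_distrib]
  push_cast
  simp only [add_zero, sub_zero]
  simp only [add_right_comm _ (1 : ℂ), add_sub_add_right_eq_sub, ← add_assoc]
  ring

theorem prod_neg_sub (C : Finset ℕ) (α : ℝ) :
    ∏ m ∈ C, ((m : ℂ) - α) = (-1) ^ C.card * ∏ m ∈ C, ((α : ℂ) - m) := by
  rw [← Finset.prod_const, ← Finset.prod_mul_distrib]
  exact Finset.prod_congr rfl fun m _ => by ring

theorem laguerreC_zero (a x : ℝ) : laguerreC 0 a x = 1 := by simp [laguerreC, laguerre]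

/-- In this cross-multiplied form the products over seeds cancel against `crossProd_down`, leaving
only the coefficient `-α` of the second solution. -/
theorem exists_omegaFinset_downOne {A A' : Finset ℕ} (h0 : 0 ∈ A) (h : A.erase 0 = succMap A')
    (B C D : Finset ℕ) : ∃ d : ℕ, ∀ {α : ℝ} {lam : ℂ} {x : ℝ}, NonInt α → 0 < x →
      omegaFinset A B C D α lam x * crossProd A' B C (succMap D) (α + 1) =
        (-1) ^ d * (-α) * (omegaFinset A' B C (succMap D) (α + 1) (lam - 1) x *
          crossProd A B C D α) := by
  have hA : A.card = A'.card + 1 := card_of_zero_mem h0 h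
  obtain ⟨d, hd⟩ := exists_omegaFinset_eq (A := A) (B := B) (C := C) (D := D) (A' := A')
    (B' := B) (C' := C) (D' := succMap D) (K := labelList (succMap A') B C D) (i₀ := .one 0)
    (σ := Label.downOne)
    (by
      rw [← Multiset.coe_eq_coe, ← Multiset.cons_coe, coe_labelList, coe_labelList,
        val_map_of_zero_mem h0 h]
      simp only [Multiset.cons_add])
    (by
      rw [← Multiset.coe_eq_coe, ← Multiset.map_coe, coe_labelList, coe_labelList]
      simp only [Multiset.map_add, Multiset.map_map, val_map_succMap, Multiset.map_singleton]
      rfl)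
  -- Signs: `-1` from each remaining first seed, and `n - α = -(α - n)` from each third seed.
  refine ⟨d + A'.card + C.card, fun {α lam x} hα hx => ?_⟩
  rw [hd hα hα.add_one hx (vs := 0) (vp := 0) (ws := 0) (wp := 0) (lam' := lam - 1)
    (c := Label.downOneCoeff α)
    (fun y _ => by simp [Label.fn, seed1_eq, expPow_zero, laguerreC_zero])
    (fun i hi y hy => hasDerivAt_downOne lam hα hy i (by
      rintro rfl
      rw [← Multiset.mem_coe, coe_labelList] at hi
      simp [succMap] at hi))
    (by rw [card_succMap]; ring) (by rw [card_succMap, hA]; push_cast; ring),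
    prod_map_labelList, prod_succMap, crossProd_down h0 h]
  simp only [Label.downOneCoeff, prod_neg_sub, Finset.prod_const, pow_add]
  ring

theorem exists_omegaFinset_upOne {D D' : Finset ℕ} (h0 : 0 ∈ D') (h : D'.erase 0 = succMap D)
    (A B C : Finset ℕ) : ∃ d : ℕ, ∀ {α : ℝ} {lam : ℂ} {x : ℝ}, NonInt α → 0 < x →
      omegaFinset (succMap A) B C D α lam x * lam * crossProd A B C D' (α + 1) =
        (-1) ^ d * (-α) * (omegaFinset A B C D' (α + 1) (lam - 1) x *
          crossProd (succMap A) B C D α) := by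
  have hD : D'.card = D.card + 1 := card_of_zero_mem h0 h
  obtain ⟨d, hd⟩ := exists_omegaFinset_eq (A := A) (B := B) (C := C) (D := D')
    (A' := succMap A) (B' := B) (C' := C) (D' := D) (K := labelList A B C (succMap D))
    (i₀ := .four 0) (σ := Label.upOne)
    (by
      rw [← Multiset.coe_eq_coe, ← Multiset.cons_coe, coe_labelList, coe_labelList,
        val_map_of_zero_mem h0 h]
      simp only [Multiset.cons_add, Multiset.add_cons])
    (by
      rw [← Multiset.coe_eq_coe, ← Multiset.map_coe, coe_labelList, coe_labelList]
      simp only [Multiset.map_add, Multiset.map_map, val_map_succMap, Multiset.map_singleton]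
      rfl)
  -- Signs: `-1` from each third seed; the extra `1` turns the coefficient `λ / α` into the uniform
  -- factor `-α`.
  refine ⟨d + 1 + C.card, fun {α lam x} hα hx => ?_⟩
  rw [hd hα.add_one hα hx (vs := -1) (vp := α + 1) (ws := -1) (wp := α) (lam' := lam)
    (c := Label.upOneCoeff α lam)
    (fun y hy => by
      rw [Label.fn, seed4_eq, ← mul_assoc, expPow_mul_expPow hy]
      simp [expPow_zero, laguerreC_zero])
    (fun i hi y hy => hasDerivAt_upOne lam hα hy i (by
      rintro rfl
      rw [← Multiset.mem_coe, coe_labelList] at hi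
      simp [succMap] at hi))
    (by rw [hD]; push_cast; ring)
    (by rw [length_labelList, card_succMap, card_succMap, hD]; push_cast; ring),
    prod_map_labelList, crossProd_up h0 h]
  have hα0 := hα.ne_zero
  have hs : ((-1 : ℂ) ^ d) ^ 2 = 1 := by rw [← pow_mul, mul_comm, pow_mul]; simp
  have hs' : ((-1 : ℂ) ^ C.card) ^ 2 = 1 := by rw [← pow_mul, mul_comm, pow_mul]; simp
  simp only [Label.upOneCoeff, Finset.prod_const, pow_add, pow_one]
  field_simp
  rw [hs, hs']
  ring

theorem exists_omegaFinset_downTwo {B B' : Finset ℕ} (h0 : 0 ∈ B) (h : B.erase 0 = succMap B')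
    (A C D : Finset ℕ) : ∃ d : ℕ, ∀ {α : ℝ} {lam : ℂ} {x : ℝ}, NonInt α → 0 < x →
      omegaFinset A B C D α lam x * crossProd A B' (succMap C) D (α + 1) =
        (-1) ^ d * (-α) * (omegaFinset A B' (succMap C) D (α + 1) lam x *
          crossProd A B C D α) := by
  have hB : B.card = B'.card + 1 := card_of_zero_mem h0 h
  obtain ⟨d, hd⟩ := exists_omegaFinset_eq (A := A) (B := B) (C := C) (D := D) (A' := A)
    (B' := B') (C' := succMap C) (D' := D) (K := labelList A (succMap B') C D) (i₀ := .two 0)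
    (σ := Label.downTwo)
    (by
      rw [← Multiset.coe_eq_coe, ← Multiset.cons_coe, coe_labelList, coe_labelList,
        val_map_of_zero_mem h0 h]
      simp only [Multiset.cons_add, Multiset.add_cons])
    (by
      rw [← Multiset.coe_eq_coe, ← Multiset.map_coe, coe_labelList, coe_labelList]
      simp only [Multiset.map_add, Multiset.map_map, val_map_succMap, Multiset.map_singleton]
      rfl)
  refine ⟨d + A.card + D.card, fun {α lam x} hα hx => ?_⟩
  rw [hd hα hα.add_one hx (vs := -1) (vp := 0) (ws := -1) (wp := 0) (lam' := lam)
    (c := Label.downTwoCoeff α)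
    (fun y hy => by
      rw [Label.fn, seed2_eq, ← mul_assoc, expPow_mul_expPow hy]
      simp [expPow_zero, laguerreC_zero])
    (fun i hi y hy => hasDerivAt_downTwo lam hα hy i (by
      rintro rfl
      rw [← Multiset.mem_coe, coe_labelList] at hi
      simp [succMap] at hi))
    (by rw [hB]; push_cast; ring) (by rw [card_succMap, hB]; push_cast; ring),
    prod_map_labelList, prod_succMap, crossProd_swap A B C D, crossProd_down h0 h,
    crossProd_swap A B']
  simp only [Label.downTwoCoeff, prod_neg_sub, Finset.prod_const, pow_add]
  ring

theorem exists_omegaFinset_upTwo {C C' : Finset ℕ} (h0 : 0 ∈ C') (h : C'.erase 0 = succMap C)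
    (A B D : Finset ℕ) : ∃ d : ℕ, ∀ {α : ℝ} {lam : ℂ} {x : ℝ}, NonInt α → 0 < x →
      omegaFinset A (succMap B) C D α lam x * (-lam - α - 1) * crossProd A B C' D (α + 1) =
        (-1) ^ d * (-α) * (omegaFinset A B C' D (α + 1) lam x *
          crossProd A (succMap B) C D α) := by
  have hC : C'.card = C.card + 1 := card_of_zero_mem h0 h
  obtain ⟨d, hd⟩ := exists_omegaFinset_eq (A := A) (B := B) (C := C') (D := D)
    (A' := A) (B' := succMap B) (C' := C) (D' := D) (K := labelList A B (succMap C) D)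
    (i₀ := .three 0) (σ := Label.upTwo)
    (by
      rw [← Multiset.coe_eq_coe, ← Multiset.cons_coe, coe_labelList, coe_labelList,
        val_map_of_zero_mem h0 h]
      simp only [Multiset.cons_add, Multiset.add_cons])
    (by
      rw [← Multiset.coe_eq_coe, ← Multiset.map_coe, coe_labelList, coe_labelList]
      simp only [Multiset.map_add, Multiset.map_map, val_map_succMap, Multiset.map_singleton]
      rfl)
  refine ⟨d + C.card, fun {α lam x} hα hx => ?_⟩
  rw [hd hα.add_one hα hx (vs := 0) (vp := α + 1) (ws := 0) (wp := α) (lam' := lam)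
    (c := Label.upTwoCoeff α lam)
    (fun y hy => by
      rw [Label.fn, seed3_eq, ← mul_assoc, expPow_mul_expPow hy]
      simp [expPow_zero, laguerreC_zero])
    (fun i hi y hy => hasDerivAt_upTwo lam hα hy i (by
      rintro rfl
      rw [← Multiset.mem_coe, coe_labelList] at hi
      simp [succMap] at hi))
    (by rw [card_succMap]; ring)
    (by rw [length_labelList, card_succMap, card_succMap, hC]; push_cast; ring),
    prod_map_labelList, crossProd_swap A B, crossProd_up h0 h, crossProd_swap A (succMap B),
    prod_succMap]
  have hα0 := hα.ne_zero
  have hs : ((-1 : ℂ) ^ d) ^ 2 = 1 := by rw [← pow_mul, mul_comm, pow_mul]; simp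
  have hs' : ((-1 : ℂ) ^ C.card) ^ 2 = 1 := by rw [← pow_mul, mul_comm, pow_mul]; simp
  simp only [Label.upTwoCoeff, Finset.prod_const, pow_add]
  field_simp
  rw [hs, hs']
  ring

/-! ### Effect of a one-box shift on Maya diagrams, and the normalized recursion. -/

namespace MayaDiagram

variable (M : MayaDiagram)

theorem mem_filled {n : ℕ} : n ∈ M.filled ↔ (n : ℤ) ∈ M.carrier := by simp [filled]

theorem mem_empty {n : ℕ} : n ∈ M.empty ↔ -(n : ℤ) - 1 ∉ M.carrier := by simp [empty]

theorem mem_shift {t k : ℤ} : k ∈ (M.shift t).carrier ↔ k - t ∈ M.carrier := Iff.rfl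

theorem shift_zero : M.shift 0 = M := by
  ext k
  simp [mem_shift]

theorem shift_shift (s t : ℤ) : (M.shift s).shift t = M.shift (s + t) := by
  ext k
  simp only [mem_shift, sub_sub, add_comm s t]

theorem erase_zero_filled : M.filled.erase 0 = succMap (M.shift (-1)).filled := by
  ext n
  cases n with
  | zero => simp [succMap]
  | succ n => simp [succMap, mem_filled, mem_shift]

theorem erase_zero_empty_shift : (M.shift (-1)).empty.erase 0 = succMap M.empty := by
  ext n
  cases n with
  | zero => simp [succMap]
  | succ n =>
    simp only [succMap, Finset.mem_erase, ne_eq, Nat.succ_ne_zero, not_false_eq_true, true_and,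
      mem_empty, mem_shift, Finset.mem_map, Function.Embedding.coeFn_mk, Nat.succ_inj,
      exists_eq_right]
    rw [show -((n + 1 : ℕ) : ℤ) - 1 - -1 = -(n : ℤ) - 1 by push_cast; ring]

/-- The box at `0` moves to `-1`, whose label is `0`. Hence exactly one of the two moves, at `M` or
backwards from `M - 1`, is available. -/
theorem zero_mem_empty_shift : 0 ∈ (M.shift (-1)).empty ↔ 0 ∉ M.filled := by
  simp [mem_empty, mem_filled, mem_shift]

theorem empty_shift_of_mem (h : 0 ∈ M.filled) : (M.shift (-1)).empty = succMap M.empty := by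
  rw [← erase_zero_empty_shift, Finset.erase_eq_of_notMem]
  rw [zero_mem_empty_shift]
  exact not_not.2 h

theorem filled_eq_of_notMem (h : 0 ∉ M.filled) : M.filled = succMap (M.shift (-1)).filled := by
  rw [← erase_zero_filled, Finset.erase_eq_of_notMem h]

theorem filled_shift_conjShift : (M.shift M.conjShift).filled = ∅ := by
  ext n
  simpa [mem_filled] using M.conjShift_spec.1 n (by positivity)

end MayaDiagram

/-- The quotient of `Ω` by the factor `D₃`. -/
noncomputable def normOmega (M₁ M₂ : MayaDiagram) (α : ℝ) (lam : ℂ) (x : ℝ) : ℂ :=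
  omegaFinset M₁.filled M₂.filled M₂.empty M₁.empty α lam x /
    crossProd M₁.filled M₂.filled M₂.empty M₁.empty α

/-- Dividing by `D₃` merges the two cases: a filled box `0` gives the downward move, an empty one
the upward move from `M₁ - 1` solved for its target, which costs the division by `lam`. -/
theorem exists_normOmega_shift_left (M₁ M₂ : MayaDiagram) :
    ∃ d : ℕ, ∀ (α : ℝ) (lam : ℂ) (x : ℝ), NonInt α → lam ≠ 0 → 0 < x →
      normOmega M₁ M₂ α lam x = (-1) ^ d * (-α / if 0 ∈ M₁.filled then 1 else lam) *
        normOmega (M₁.shift (-1)) M₂ (α + 1) (lam - 1) x := by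
  by_cases h0 : 0 ∈ M₁.filled
  · obtain ⟨d, hd⟩ := exists_omegaFinset_downOne h0 M₁.erase_zero_filled M₂.filled M₂.empty
      M₁.empty
    refine ⟨d, fun α lam x hα _ hx => ?_⟩
    have h := hd (lam := lam) hα hx
    rw [if_pos h0, div_one, normOmega, normOmega, M₁.empty_shift_of_mem h0, ← mul_div_assoc,
      div_eq_div_iff (crossProd_ne_zero _ _ _ _ hα) (crossProd_ne_zero _ _ _ _ hα.add_one), h]
    ring
  · have h1 := M₁.zero_mem_empty_shift.2 h0
    obtain ⟨d, hd⟩ := exists_omegaFinset_upOne h1 M₁.erase_zero_empty_shift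
      (M₁.shift (-1)).filled M₂.filled M₂.empty
    rw [← M₁.filled_eq_of_notMem h0] at hd
    refine ⟨d, fun α lam x hα hl hx => ?_⟩
    have h := hd (lam := lam) hα hx
    rw [if_neg h0, normOmega, normOmega, ← mul_div_assoc,
      div_eq_div_iff (crossProd_ne_zero _ _ _ _ hα) (crossProd_ne_zero _ _ _ _ hα.add_one)]
    refine mul_right_cancel₀ hl ?_
    rw [mul_right_comm, h]
    field_simp

theorem exists_normOmega_shift_right (M₁ M₂ : MayaDiagram) :
    ∃ d : ℕ, ∀ (α : ℝ) (lam : ℂ) (x : ℝ), NonInt α → -lam - α - 1 ≠ 0 → 0 < x →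
      normOmega M₁ M₂ α lam x = (-1) ^ d * (-α / if 0 ∈ M₂.filled then 1 else -lam - α - 1) *
        normOmega M₁ (M₂.shift (-1)) (α + 1) lam x := by
  by_cases h0 : 0 ∈ M₂.filled
  · obtain ⟨d, hd⟩ := exists_omegaFinset_downTwo h0 M₂.erase_zero_filled M₁.filled M₂.empty
      M₁.empty
    refine ⟨d, fun α lam x hα _ hx => ?_⟩
    have h := hd (lam := lam) hα hx
    rw [if_pos h0, div_one, normOmega, normOmega, M₂.empty_shift_of_mem h0, ← mul_div_assoc,
      div_eq_div_iff (crossProd_ne_zero _ _ _ _ hα) (crossProd_ne_zero _ _ _ _ hα.add_one), h]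
    ring
  · have h1 := M₂.zero_mem_empty_shift.2 h0
    obtain ⟨d, hd⟩ := exists_omegaFinset_upTwo h1 M₂.erase_zero_empty_shift
      M₁.filled (M₂.shift (-1)).filled M₁.empty
    rw [← M₂.filled_eq_of_notMem h0] at hd
    refine ⟨d, fun α lam x hα hl hx => ?_⟩
    have h := hd (lam := lam) hα hx
    rw [if_neg h0, normOmega, normOmega, ← mul_div_assoc,
      div_eq_div_iff (crossProd_ne_zero _ _ _ _ hα) (crossProd_ne_zero _ _ _ _ hα.add_one)]
    refine mul_right_cancel₀ hl ?_
    rw [mul_right_comm, h]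
    field_simp

/-! ### Generic parameters and iteration of the recursion. -/

/-- Neither `α`, nor `μ`, nor `μ + α` is an integer. -/
structure Generic (α : ℝ) (μ : ℂ) : Prop where
  nonInt : NonInt α
  ne_int : ∀ k : ℤ, μ ≠ k
  add_ne_int : ∀ k : ℤ, μ + α ≠ k

theorem Generic.shift {α : ℝ} {μ : ℂ} (h : Generic α μ) (s t : ℤ) :
    Generic (α + s) (μ + t) where
  nonInt := h.nonInt.add_int s
  ne_int k hk := h.ne_int (k - t) (by push_cast; linear_combination hk)
  add_ne_int k hk := h.add_ne_int (k - s - t) (by push_cast at *; linear_combination hk)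

/-- The involution `μ ↦ -μ - α - 1` turns the recursion for the second diagram into the form of that
for the first, so that one iteration argument serves both. -/
theorem Generic.reflect {α : ℝ} {μ : ℂ} (h : Generic α μ) : Generic α (-μ - α - 1) where
  nonInt := h.nonInt
  ne_int k hk := h.add_ne_int (-k - 1) (by push_cast; linear_combination -hk)
  add_ne_int k hk := h.ne_int (-k - 1) (by push_cast; linear_combination -hk)

section Iteration

variable {R : MayaDiagram → ℝ → ℂ → ℝ → ℂ}

/-- Each step contributes one factor of the falling factorial of `-α`, and a factor `μ - k` exactly
when box `k` is empty. -/
theorem exists_iterate_down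
    (hR : ∀ M : MayaDiagram, ∃ d : ℕ, ∀ α μ x, Generic α μ → 0 < x →
      R M α μ x = (-1) ^ d * (-α / if 0 ∈ M.filled then 1 else μ) *
        R (M.shift (-1)) (α + 1) (μ - 1) x) (M : MayaDiagram) (n : ℕ) :
    ∃ d : ℕ, ∀ α μ x, Generic α μ → 0 < x →
      R M α μ x = (-1) ^ d * ((descPochhammer ℂ n).eval (-(α : ℂ)) /
        ∏ k ∈ Finset.range n \ M.filled, (μ - k)) * R (M.shift (-n)) (α + n) (μ - n) x := by
  induction n with
  | zero => exact ⟨0, fun α μ x _ _ => by simp [MayaDiagram.shift_zero]⟩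
  | succ n ih =>
    obtain ⟨d, hd⟩ := ih
    obtain ⟨e, he⟩ := hR (M.shift (-n))
    refine ⟨d + e, fun α μ x hG hx => ?_⟩
    have hG' : Generic (α + n) (μ - n) := by
      simpa [sub_eq_add_neg] using hG.shift n (-n)
    have hmem : 0 ∈ (M.shift (-n)).filled ↔ n ∈ M.filled := by
      simp [MayaDiagram.mem_filled, MayaDiagram.mem_shift]
    have hprod : ∏ k ∈ Finset.range (n + 1) \ M.filled, (μ - k) =
        (∏ k ∈ Finset.range n \ M.filled, (μ - k)) * if n ∈ M.filled then 1 else (μ - n) := by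
      split_ifs with h
      · rw [Finset.range_add_one, Finset.insert_sdiff_of_mem _ h, mul_one]
      · rw [Finset.range_add_one, Finset.insert_sdiff_of_notMem _ h,
          Finset.prod_insert (by simp), mul_comm]
    rw [hd α μ x hG hx, he _ _ x hG' hx, hprod, descPochhammer_succ_eval,
      MayaDiagram.shift_shift]
    simp only [hmem]
    push_cast
    rw [show -(n : ℤ) + -1 = -(n + 1) by ring, ← add_assoc, ← sub_sub, pow_add]
    simp only [div_eq_mul_inv, mul_inv]
    ring

/-- The recursion is read backwards. By `hM` every box that is passed is empty, so the inverse
factor is always of the kind `μ / (-α)`. -/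
theorem exists_iterate_up
    (hR : ∀ M : MayaDiagram, ∃ d : ℕ, ∀ α μ x, Generic α μ → 0 < x →
      R M α μ x = (-1) ^ d * (-α / if 0 ∈ M.filled then 1 else μ) *
        R (M.shift (-1)) (α + 1) (μ - 1) x) (M : MayaDiagram) (n : ℕ)
    (hM : ∀ k < n, k ∈ M.empty) :
    ∃ d : ℕ, ∀ α μ x, Generic α μ → 0 < x →
      R M α μ x = (-1) ^ d * ((ascPochhammer ℂ n).eval (μ + 1) /
        (ascPochhammer ℂ n).eval (1 - (α : ℂ))) * R (M.shift n) (α - n) (μ + n) x := by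
  induction n with
  | zero => exact ⟨0, fun α μ x _ _ => by simp [MayaDiagram.shift_zero]⟩
  | succ n ih =>
    obtain ⟨d, hd⟩ := ih fun k hk => hM k (by omega)
    -- The recursion at `M.shift (n + 1)` leads down to `M.shift n`; it is inverted below.
    obtain ⟨e, he⟩ := hR (M.shift (n + 1))
    refine ⟨d + e, fun α μ x hG hx => ?_⟩
    have hG' : Generic (α - (n + 1 : ℕ)) (μ + (n + 1 : ℕ)) := by
      simpa [sub_eq_add_neg] using hG.shift (-(n + 1)) (n + 1)
    have hmem : 0 ∉ (M.shift (n + 1)).filled := by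
      have := hM n (by omega)
      rw [MayaDiagram.mem_empty] at this
      rw [MayaDiagram.mem_filled, MayaDiagram.mem_shift]
      convert this using 2
      push_cast
      ring
    have h := he _ _ x hG' hx
    have h1 : μ + 1 + n ≠ 0 := by
      have := hG'.ne_int 0
      push_cast at this
      rwa [add_assoc, add_comm 1]
    have h2 : 1 - (α : ℂ) + n ≠ 0 := hG.nonInt.one_sub_add_natCast_ne n
    have hs : ((-1 : ℂ) ^ e) ^ 2 = 1 := by rw [← pow_mul, mul_comm, pow_mul]; simp
    rw [if_neg hmem, MayaDiagram.shift_shift] at h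
    push_cast at h
    rw [show (n : ℤ) + 1 + -1 = n by ring, show α - (n + 1) + 1 = α - n by ring,
      show μ + (n + 1) - 1 = μ + n by ring] at h
    rw [hd α μ x hG hx, ascPochhammer_succ_eval, ascPochhammer_succ_eval]
    push_cast
    rw [h, pow_add, show -((α : ℂ) - (n + 1)) = 1 - α + n by ring,
      show μ + (n + 1) = μ + 1 + n by ring]
    have h3 : (1 - (α : ℂ) + n) / (μ + 1 + n) * ((μ + 1 + n) / (1 - (α : ℂ) + n)) = 1 := by
      field_simp
    simp only [mul_div_mul_comm]
    linear_combination (-(-1 : ℂ) ^ d * (Polynomial.eval (μ + 1) (ascPochhammer ℂ n) /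
      Polynomial.eval (1 - (α : ℂ)) (ascPochhammer ℂ n)) * R (M.shift n) (α - n) (μ + n) x) *
        (h3 * ((-1 : ℂ) ^ e) ^ 2 + hs)

theorem exists_conjShift_eq
    (hR : ∀ M : MayaDiagram, ∃ d : ℕ, ∀ α μ x, Generic α μ → 0 < x →
      R M α μ x = (-1) ^ d * (-α / if 0 ∈ M.filled then 1 else μ) *
        R (M.shift (-1)) (α + 1) (μ - 1) x) (M : MayaDiagram) :
    ∃ d : ℕ, ∀ α μ x, Generic α μ → 0 < x →
      R M α μ x = (-1) ^ d * D₁ α μ M *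
        R (M.shift M.conjShift) (α - M.conjShift) (μ + M.conjShift) x := by
  rcases lt_trichotomy M.conjShift 0 with ht | ht | ht
  · obtain ⟨d, hd⟩ := exists_iterate_down hR M M.conjShift.natAbs
    refine ⟨d, fun α μ x hG hx => ?_⟩
    have h1 : ((M.conjShift.natAbs : ℕ) : ℤ) = -M.conjShift := by omega
    have h2 : (M.conjShift.natAbs : ℝ) = -M.conjShift := by
      rw [← Int.cast_natCast, h1, Int.cast_neg]
    have h3 : (M.conjShift.natAbs : ℂ) = -M.conjShift := by
      rw [← Int.cast_natCast, h1, Int.cast_neg]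
    rw [hd α μ x hG hx, D₁, if_pos ht, h1, h2, h3, neg_neg, sub_neg_eq_add, ← sub_eq_add_neg]
  · refine ⟨0, fun α μ x _ _ => ?_⟩
    simp [D₁, ht, MayaDiagram.shift_zero]
  · have h1 : ((M.conjShift.natAbs : ℕ) : ℤ) = M.conjShift := by omega
    obtain ⟨d, hd⟩ := exists_iterate_up hR M M.conjShift.natAbs fun k hk => by
      rw [MayaDiagram.mem_empty]
      intro h
      -- A filled box `-k - 1` would land at `t - k - 1 ≥ 0`, contradicting canonical form.
      refine M.conjShift_spec.1 (M.conjShift - k - 1) (by omega) ?_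
      rw [MayaDiagram.mem_shift]
      convert h using 1
      ring
    refine ⟨d, fun α μ x hG hx => ?_⟩
    have h2 : (M.conjShift.natAbs : ℝ) = M.conjShift := by
      rw [← Int.cast_natCast, h1]
    have h3 : (M.conjShift.natAbs : ℂ) = M.conjShift := by
      rw [← Int.cast_natCast, h1]
    rw [hd α μ x hG hx, D₁, if_neg ht.not_gt, if_neg ht.ne', h1, h2, h3]

end Iteration

/-! ### The theorem for generic parameters. -/

/-- The reflected spectral parameter is taken with `α` and `lam` before the first shift: `-λ - α -
1` is unchanged under `(α, λ) ↦ (α - t, λ + t)`. -/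
theorem D₂_eq_D₁ (α : ℝ) (lam : ℂ) (t : ℤ) (M : MayaDiagram) :
    D₂ α lam t M = D₁ (α - t) (-lam - α - 1) M := by
  simp only [D₁, D₂]
  push_cast
  rw [neg_sub', sub_neg_eq_add, sub_add_cancel, sub_sub_eq_add_sub, add_sub_right_comm]

theorem exists_normOmega_eq (M₁ M₂ : MayaDiagram) :
    ∃ d : ℕ, ∀ (α : ℝ) (lam : ℂ) (x : ℝ), Generic α lam → 0 < x →
      normOmega M₁ M₂ α lam x = (-1) ^ d * (D₁ α lam M₁ * D₂ α lam M₁.conjShift M₂) *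
        normOmega (M₁.shift M₁.conjShift) (M₂.shift M₂.conjShift)
          (α - M₁.conjShift - M₂.conjShift) (lam + M₁.conjShift) x := by
  obtain ⟨d, hd⟩ := exists_conjShift_eq (R := fun M α μ x => normOmega M M₂ α μ x) (fun M => by
    obtain ⟨d, hd⟩ := exists_normOmega_shift_left M M₂
    exact ⟨d, fun α μ x hG hx => hd α μ x hG.nonInt (by simpa using hG.ne_int 0) hx⟩) M₁
  -- For the second diagram the family is written in the reflected parameter, so that a shift lowers
  -- `μ` while the spectral parameter of `Ω` stays fixed.
  obtain ⟨e, he⟩ := exists_conjShift_eq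
    (R := fun M α μ x => normOmega (M₁.shift M₁.conjShift) M α (-μ - α - 1) x) (fun M => by
    obtain ⟨d, hd⟩ := exists_normOmega_shift_right (M₁.shift M₁.conjShift) M
    refine ⟨d, fun α μ x hG hx => ?_⟩
    have hμ : -(-μ - α - 1) - α - 1 = μ := by ring
    have := hd α (-μ - α - 1) x hG.nonInt (by rw [hμ]; simpa using hG.ne_int 0) hx
    rw [hμ] at this
    simp only [this]
    push_cast
    rw [show -(μ - 1) - (α + 1 : ℂ) - 1 = -μ - α - 1 by ring]) M₂
  refine ⟨d + e, fun α lam x hG hx => ?_⟩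
  have hG₁ : Generic (α - M₁.conjShift) (lam + M₁.conjShift) := by
    simpa [sub_eq_add_neg] using hG.shift (-M₁.conjShift) M₁.conjShift
  have h1 := hd α lam x hG hx
  have h2 := he _ _ x hG₁.reflect hx
  push_cast at h2
  rw [show -(-(lam + M₁.conjShift) - (α - M₁.conjShift) - 1) - (α - M₁.conjShift : ℂ) - 1
    = lam + M₁.conjShift by ring, show -(-(lam + M₁.conjShift) - (α - M₁.conjShift) - 1 +
      M₂.conjShift) - (α - M₁.conjShift - M₂.conjShift : ℂ) - 1 = lam + M₁.conjShift by ring,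
    show -(lam + M₁.conjShift) - (α - M₁.conjShift) - 1 = -lam - (α : ℂ) - 1 by ring] at h2
  rw [h1, h2, D₂_eq_D₁, pow_add]
  ring

theorem omegaMaya_eq_omegaFinset (M₁ M₂ : MayaDiagram) (α : ℝ) (lam : ℂ) (x : ℝ) :
    omegaMaya M₁ M₂ α lam x
      = omegaFinset M₁.filled M₂.filled M₂.empty M₁.empty α lam x :=
  omegaSeq_eq_omegaFinset _ _ _ _ _ _ _

/-- In a strictly decreasing sequence of naturals each entry is at least the number of entries after
it, so the truncated subtraction loses nothing. -/
theorem partitionDegrees_mapIdx {s : List ℕ} (hs : s.Pairwise (· > ·)) :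
    partitionDegrees (s.mapIdx fun j n => n - (s.length - (j + 1))) = s := by
  have key : ∀ (l : List ℕ), l.Pairwise (· > ·) → ∀ j (hj : j < l.length),
      l.length - (j + 1) ≤ l[j] := by
    intro l hl
    induction hl with
    | nil => simp
    | @cons a l h _ ih =>
      intro j hj
      cases j with
      | succ j => simpa using ih j (by simpa using hj)
      | zero =>
        cases l with
        | nil => simp
        | cons b l =>
          have h1 := ih 0 (by simp)
          have h2 := h b (by simp)
          simp at h1 ⊢
          omega
  refine List.ext_getElem (by simp [partitionDegrees]) fun j h1 h2 => ?_
  have := key s hs j h2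
  simp only [partitionDegrees, List.getElem_mapIdx, List.length_mapIdx]
  omega

theorem partitionDegrees_conjPartition (M : MayaDiagram) :
    partitionDegrees M.conjPartition = (M.shift M.conjShift).emptySeq :=
  partitionDegrees_mapIdx (Finset.sortedGT_sort _).pairwise

theorem omegaConj_eq_omegaFinset (M₁ M₂ : MayaDiagram) (α : ℝ) (lam : ℂ) (x : ℝ) :
    omegaConj M₁.conjPartition M₂.conjPartition α lam x =
      omegaFinset ∅ ∅ (M₂.shift M₂.conjShift).empty (M₁.shift M₁.conjShift).empty α lam x := by
  rw [omegaConj, partitionDegrees_conjPartition, partitionDegrees_conjPartition,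
    ← omegaSeq_eq_omegaFinset]
  simp only [Finset.sort_empty]
  rfl

/-- The theorem for generic parameters. -/
theorem exists_omegaMaya_eq_of_generic (M₁ M₂ : MayaDiagram) :
    ∃ d : ℕ, ∀ (α : ℝ) (lam : ℂ) (x : ℝ), Generic α lam → 0 < x →
      omegaMaya M₁ M₂ α lam x =
        (-1) ^ d * (D₁ α lam M₁ * D₂ α lam M₁.conjShift M₂ * D₃ α M₁ M₂) *
          omegaConj M₁.conjPartition M₂.conjPartition
            (α - M₁.conjShift - M₂.conjShift) (lam + M₁.conjShift) x := by
  obtain ⟨d, hd⟩ := exists_normOmega_eq M₁ M₂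
  refine ⟨d, fun α lam x hG hx => ?_⟩
  have h := hd α lam x hG hx
  have h0 := crossProd_ne_zero M₁.filled M₂.filled M₂.empty M₁.empty hG.nonInt
  rw [normOmega, normOmega, MayaDiagram.filled_shift_conjShift,
    MayaDiagram.filled_shift_conjShift, ← omegaMaya_eq_omegaFinset, ← omegaConj_eq_omegaFinset,
    div_eq_iff h0] at h
  rw [h, show D₃ α M₁ M₂ = crossProd M₁.filled M₂.filled M₂.empty M₁.empty α from rfl]
  -- The canonical diagrams have no filled boxes to the right of the origin, so their `crossProd` is
  -- an empty product.
  simp [crossProd]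
  ring

/-! ### Continuity of both sides in the parameters. -/

section

/-- The functions `F ε` are smooth at `x` for small `ε`, and their derivatives at `x` depend
continuously on `ε` at `0`. -/
structure JetContinuous (F : ℝ → ℝ → ℂ) (x : ℝ) : Prop where
  smooth : ∀ᶠ ε in 𝓝 0, ∀ k : ℕ, ContDiffAt ℝ k (F ε) x
  continuousAt : ∀ k : ℕ, ContinuousAt (fun ε => iteratedDeriv k (F ε) x) 0

variable {x : ℝ}

theorem JetContinuous.mul {F G : ℝ → ℝ → ℂ} (hF : JetContinuous F x) (hG : JetContinuous G x) :
    JetContinuous (fun ε y => F ε y * G ε y) x where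
  smooth := by
    filter_upwards [hF.smooth, hG.smooth] with ε h1 h2 k using (h1 k).mul (h2 k)
  continuousAt k := by
    have h : ContinuousAt (fun ε => ∑ i ∈ Finset.range (k + 1), (k.choose i : ℂ) *
        iteratedDeriv i (F ε) x * iteratedDeriv (k - i) (G ε) x) 0 :=
      tendsto_finsetSum _ fun i _ =>
        (tendsto_const_nhds.mul (hF.continuousAt i)).mul (hG.continuousAt (k - i))
    refine h.congr ?_
    filter_upwards [hF.smooth, hG.smooth] with ε h1 h2
    exact (iteratedDeriv_fun_mul (h1 k) (h2 k)).symm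

theorem hasDerivAt_expPow (hx : 0 < x) (s p : ℝ) :
    HasDerivAt (expPow s p) (s * expPow s p x + p * expPow s (p - 1) x) x := by
  have h := hasDerivAt_expPow_mul hx s p (hasDerivAt_const x (1 : ℂ))
  simp only [mul_one, mul_zero, add_zero] at h
  refine h.congr_deriv ?_
  have : expPow s p x = x * expPow s (p - 1) x := by
    simp only [expPow, Real.rpow_sub_one hx.ne']
    have : (x : ℂ) ≠ 0 := by exact_mod_cast hx.ne'
    push_cast
    field_simp
  rw [this]
  ring

/-- Differentiation brings in the exponent `p - 1`, so the induction on the order runs over all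
continuous exponents at once. -/
theorem jetContinuous_expPow (hx : 0 < x) (s : ℝ) {p : ℝ → ℝ} (hp : ContinuousAt p 0) :
    JetContinuous (fun ε => expPow s (p ε)) x where
  smooth := Eventually.of_forall fun ε => contDiffAt_expPow hx s (p ε)
  continuousAt k := by
    induction k generalizing p with
    | zero =>
      simp only [iteratedDeriv_zero, expPow]
      exact Complex.continuous_ofReal.continuousAt.comp
        (continuousAt_const.mul (continuousAt_const.rpow hp (Or.inl hx.ne')))
    | succ k ih =>
      have h : ∀ ε, iteratedDeriv (k + 1) (expPow s (p ε)) x =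
          s * iteratedDeriv k (expPow s (p ε)) x +
            p ε * iteratedDeriv k (expPow s (p ε - 1)) x := by
        intro ε
        have h1 : deriv (expPow s (p ε)) =ᶠ[𝓝 x]
            fun y => s * expPow s (p ε) y + p ε * expPow s (p ε - 1) y :=
          (lt_mem_nhds hx).mono fun y hy => (hasDerivAt_expPow hy s (p ε)).deriv
        rw [iteratedDeriv_succ', h1.iteratedDeriv_eq, iteratedDeriv_fun_add
          (contDiffAt_const.mul (contDiffAt_expPow hx _ _ _))
          (contDiffAt_const.mul (contDiffAt_expPow hx _ _ _)), iteratedDeriv_const_mul_field,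
          iteratedDeriv_const_mul_field]
      simp only [h]
      exact (continuousAt_const.mul (ih hp)).add
        ((Complex.continuous_ofReal.continuousAt.comp hp).mul (ih (hp.sub continuousAt_const)))

/-- Applies to Laguerre polynomials, where the parameter enters only through the coefficients. -/
theorem jetContinuous_sum {ι : Type*} (s : Finset ι) {c : ι → ℝ → ℂ} {g : ι → ℝ → ℂ}
    (hc : ∀ i ∈ s, ContinuousAt (c i) 0) (hg : ∀ i ∈ s, ∀ k : ℕ, ContDiffAt ℝ k (g i) x) :
    JetContinuous (fun ε y => ∑ i ∈ s, c i ε * g i y) x where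
  smooth := Eventually.of_forall fun ε k =>
    ContDiffAt.sum fun i hi => contDiffAt_const.mul (hg i hi k)
  continuousAt k := by
    have h : ∀ ε, iteratedDeriv k (fun y => ∑ i ∈ s, c i ε * g i y) x =
        ∑ i ∈ s, c i ε * iteratedDeriv k (g i) x := by
      intro ε
      rw [iteratedDeriv_fun_sum fun i hi => contDiffAt_const.mul (hg i hi k)]
      simp only [iteratedDeriv_const_mul_field]
    simp only [h]
    exact tendsto_finsetSum _ fun i hi => (hc i hi).mul continuousAt_const

theorem jetContinuous_laguerreC_comp (n : ℕ) {a : ℝ → ℝ} (ha : ContinuousAt a 0) {u : ℝ → ℝ}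
    (hu : ∀ k : ℕ, ContDiffAt ℝ k u x) : JetContinuous (fun ε y => laguerreC n (a ε) (u y)) x := by
  have h := jetContinuous_sum (x := x) (Finset.range (n + 1))
    (c := fun k ε => (((-1) ^ k * ((ascPochhammer ℝ (n - k)).eval (a ε + k + 1) /
      (n - k).factorial) : ℝ) : ℂ))
    (g := fun k y => ((u y ^ k / k.factorial : ℝ) : ℂ))
    (fun k _ => Complex.continuous_ofReal.continuousAt.comp (continuousAt_const.mul
      (((ascPochhammer ℝ (n - k)).continuous.continuousAt.comp
        ((ha.add continuousAt_const).add continuousAt_const)).div_const _)))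
    (fun k _ m => Complex.ofRealCLM.contDiff.contDiffAt.comp x (((hu m).pow k).div_const _))
  simpa [laguerreC, laguerre] using h

theorem continuousAt_ascPochhammer_eval (k : ℕ) {a : ℝ → ℂ} (ha : ContinuousAt a 0) :
    ContinuousAt (fun ε => (ascPochhammer ℂ k).eval (a ε)) 0 :=
  (ascPochhammer ℂ k).continuous.continuousAt.comp ha

/-- Near `0` the values `b ε + k` stay away from zero uniformly in `k`, which gives one geometric
bound for all nearby parameters and hence `continuousAt_egf` for every derivative. -/
theorem jetContinuous_kummerM {a b : ℝ → ℂ} (ha : ContinuousAt a 0) (hb : ContinuousAt b 0)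
    (hb0 : ∀ k : ℕ, b 0 + k ≠ 0) : JetContinuous (fun ε y => kummerM (a ε) (b ε) y) x := by
  obtain ⟨δ, hδ, h⟩ := exists_pos_le_norm_add_natCast hb0
  have hb1 : ∀ᶠ ε in 𝓝 0, ∀ k : ℕ, δ / 2 ≤ ‖b ε + k‖ := by
    filter_upwards [hb.eventually (Metric.ball_mem_nhds (b 0) (half_pos hδ))] with ε hε k
    rw [dist_eq_norm] at hε
    have h1 := norm_sub_le (b ε + k) (b ε - b 0)
    rw [show b ε + k - (b ε - b 0) = b 0 + k by ring] at h1
    linarith [h k]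
  have hb2 : ∀ᶠ ε in 𝓝 0, ∀ k : ℕ, b ε + k ≠ 0 := hb1.mono fun ε hε k =>
    norm_pos_iff.1 ((half_pos hδ).trans_le (hε k))
  have hab : ∀ᶠ ε in 𝓝 0, ‖a ε - b ε‖ ≤ ‖a 0 - b 0‖ + 1 :=
    ((ha.sub hb).norm.eventually_lt continuousAt_const (by simp)).mono fun ε hε => hε.le
  refine ⟨hb2.mono fun ε hε k => (contDiff_kummerM _ hε k).contDiffAt, fun k => ?_⟩
  have hcont : ContinuousAt (fun ε => egf (fun m => kummerCoeff (a ε) (b ε) (m + k)) x) 0 := by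
    set R := 1 + (‖a 0 - b 0‖ + 1) / (δ / 2)
    -- The `k`-th derivative shifts the coefficients by `k`, at the price of a factor `R ^ k`.
    refine continuousAt_egf (C := R ^ k) (R := R) ?_ (fun m => ?_) x
    · filter_upwards [hb1, hab] with ε h1 h2 m
      have := norm_kummerCoeff_le (half_pos hδ) h1 h2 (m + k)
      rwa [one_mul, pow_add, mul_comm] at this
    · exact (continuousAt_ascPochhammer_eval _ ha).div (continuousAt_ascPochhammer_eval _ hb)
        (ascPochhammer_eval_ne_zero hb0 _)
  refine hcont.congr ?_
  filter_upwards [hb2] with ε hε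
  have := congrFun (iteratedDeriv_egf k (geomBdd_kummerCoeff (a ε) hε)) x
  exact this.symm

end

section Parameters

variable {x : ℝ} {α : ℝ → ℝ} {lam : ℝ → ℂ}

theorem continuousAt_ofReal_comp (hα : ContinuousAt α 0) :
    ContinuousAt (fun ε => (α ε : ℂ)) 0 :=
  Complex.continuous_ofReal.continuousAt.comp hα

theorem Label.jetContinuous_fn (hx : 0 < x) (hα : ContinuousAt α 0) (hlam : ContinuousAt lam 0)
    (h0 : ∀ k : ℕ, 1 - (α 0 : ℂ) + k ≠ 0) (i : Label) :
    JetContinuous (fun ε => i.fn (α ε) (lam ε)) x := by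
  have hc : ContinuousAt (fun _ : ℝ => (0 : ℝ)) 0 := continuousAt_const
  have hα₁ : ContinuousAt (fun ε => -α ε) 0 := hα.neg
  have hid : ∀ k : ℕ, ContDiffAt ℝ k (fun y : ℝ => y) x := fun k => contDiffAt_id
  have hneg : ∀ k : ℕ, ContDiffAt ℝ k (fun y : ℝ => -y) x := fun k => contDiffAt_id.neg
  cases i with
  | one n =>
    simpa only [Label.fn, ← seed1_eq] using
      (jetContinuous_expPow hx 0 hc).mul (jetContinuous_laguerreC_comp n hα hid)
  | two n =>
    simpa only [Label.fn, ← seed2_eq] using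
      (jetContinuous_expPow hx 1 hc).mul (jetContinuous_laguerreC_comp n hα hneg)
  | three n =>
    simpa only [Label.fn, ← seed3_eq] using
      (jetContinuous_expPow hx 0 hα₁).mul (jetContinuous_laguerreC_comp n hα₁ hid)
  | four n =>
    simpa only [Label.fn, ← seed4_eq] using
      (jetContinuous_expPow hx 1 hα₁).mul (jetContinuous_laguerreC_comp n hα₁ hneg)
  | sol =>
    have hα' := continuousAt_ofReal_comp hα
    simpa only [Label.fn, ← hTilde_eq] using
      (jetContinuous_expPow hx 0 hα₁).mul
        (jetContinuous_kummerM (a := fun ε => -lam ε - α ε) (b := fun ε => 1 - α ε)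
          (hlam.neg.sub hα') (continuousAt_const.sub hα') h0)

theorem continuousAt_omegaFinset (A B C D : Finset ℕ) (hx : 0 < x) (hα : ContinuousAt α 0)
    (hlam : ContinuousAt lam 0) (h0 : ∀ k : ℕ, 1 - (α 0 : ℂ) + k ≠ 0) :
    ContinuousAt (fun ε => omegaFinset A B C D (α ε) (lam ε) x) 0 := by
  have h1 : ContinuousAt (fun ε => expPow (-(B.card + D.card))
      ((α ε + A.card + B.card) * (C.card + D.card + 1)) x) 0 :=
    (jetContinuous_expPow hx _ (((hα.add continuousAt_const).add continuousAt_const).mul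
      continuousAt_const)).continuousAt 0
  refine h1.mul ?_
  simp only [wronskian_map, wronskianFin]
  refine continuous_id.matrix_det.continuousAt.comp
    (continuousAt_pi.2 fun i => continuousAt_pi.2 fun j => ?_)
  exact (Label.jetContinuous_fn hx hα hlam h0 _).continuousAt _

theorem continuousAt_D₁ (M : MayaDiagram) (hα : ContinuousAt α 0) (hlam : ContinuousAt lam 0)
    (h0 : ∀ k : ℕ, 1 - (α 0 : ℂ) + k ≠ 0)
    (h1 : ∀ k : ℕ, (k : ℤ) < -M.conjShift → (k : ℤ) ∉ M.carrier → lam 0 ≠ k) :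
    ContinuousAt (fun ε => D₁ (α ε) (lam ε) M) 0 := by
  have hα' := continuousAt_ofReal_comp hα
  unfold D₁
  simp only
  split_ifs with ht ht'
  · refine ((descPochhammer ℂ _).continuous.continuousAt.comp hα'.neg).div
      (tendsto_finsetProd _ fun k _ => hlam.sub continuousAt_const) ?_
    refine Finset.prod_ne_zero_iff.2 fun k hk => sub_ne_zero.2 ?_
    rw [Finset.mem_sdiff, Finset.mem_range, MayaDiagram.mem_filled] at hk
    exact h1 k (by omega) hk.2
  · exact continuousAt_const
  · exact (continuousAt_ascPochhammer_eval _ (hlam.add continuousAt_const)).div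
      (continuousAt_ascPochhammer_eval _ (continuousAt_const.sub hα'))
      (ascPochhammer_eval_ne_zero h0 _)

theorem continuousAt_D₃ (M₁ M₂ : MayaDiagram) (hα : ContinuousAt α 0) :
    ContinuousAt (fun ε => D₃ (α ε) M₁ M₂) 0 := by
  have hα' := continuousAt_ofReal_comp hα
  have h : ∀ A C : Finset ℕ,
      ContinuousAt (fun ε => ∏ n ∈ A, ∏ m ∈ C, ((n : ℂ) + α ε - m)) 0 := fun A C =>
    tendsto_finsetProd _ fun n _ => tendsto_finsetProd _ fun m _ =>
      (continuousAt_const.add hα').sub continuousAt_const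
  exact (((h _ _).mul (h _ _)).mul continuousAt_const).mul continuousAt_const

end Parameters

/-! ### Density of generic parameters and conclusion. -/

/-- Perturbations of the parameters along a line are generic outside a dense set. -/
theorem dense_generic (a : ℝ) (l : ℂ) :
    Dense {ε : ℝ | Generic (a + ε) (l + ε * Complex.I)} := by
  -- A real shift of `α` meets integers only countably often; the imaginary shift makes `λ` and `λ +
  -- α` non-real except at `ε = -Im λ`.
  have hc : (Set.range (fun k : ℤ => (k : ℝ) - a) ∪ {-l.im}).Countable :=
    (Set.countable_range _).union (Set.countable_singleton _)
  refine (hc.dense_compl ℝ).mono fun ε hε => ?_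
  simp only [Set.mem_compl_iff, Set.mem_union, Set.mem_range, Set.mem_singleton_iff, not_or,
    not_exists] at hε
  refine ⟨fun k hk => hε.1 k (by linarith), fun k hk => hε.2 ?_, fun k hk => hε.2 ?_⟩
  · have := congrArg Complex.im hk
    simp at this
    linarith
  · have := congrArg Complex.im hk
    simp at this
    linarith

theorem one_sub_add_natCast_ne_zero {a : ℝ} (h : ∀ k : ℕ, a ≠ k + 1) (k : ℕ) :
    1 - (a : ℂ) + k ≠ 0 := by
  intro hk
  refine h k ?_
  have : (a : ℂ) = k + 1 := by linear_combination -hk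
  exact_mod_cast this

end ExcLaguerre

theorem mainTheorem3 (M₁ M₂ : ExcLaguerre.MayaDiagram) :
    ∃ d : ℕ, ∀ (α : ℝ) (lam : ℂ),
      -- none of the three parameters of the second solution that occur is a positive integer
      (∀ k : ℕ, α ≠ k + 1) →
      (∀ k : ℕ, α - M₁.conjShift ≠ k + 1) →
      (∀ k : ℕ, α - M₁.conjShift - M₂.conjShift ≠ k + 1) →
      -- the denominators that contain the spectral parameter do not vanish
      (∀ k : ℕ, (k : ℤ) < -M₁.conjShift → (k : ℤ) ∉ M₁.carrier → lam ≠ k) →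
      (∀ k : ℕ, (k : ℤ) < -M₂.conjShift → (k : ℤ) ∉ M₂.carrier → lam ≠ -α - 1 - k) →
      ∀ x : ℝ, 0 < x →
        ExcLaguerre.omegaMaya M₁ M₂ α lam x =
          (-1) ^ d * (ExcLaguerre.D₁ α lam M₁ * ExcLaguerre.D₂ α lam M₁.conjShift M₂ *
            ExcLaguerre.D₃ α M₁ M₂) *
          ExcLaguerre.omegaConj M₁.conjPartition M₂.conjPartition
            (α - M₁.conjShift - M₂.conjShift) (lam + M₁.conjShift) x := by
  obtain ⟨d, hd⟩ := ExcLaguerre.exists_omegaMaya_eq_of_generic M₁ M₂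
  refine ⟨d, fun α lam h₁ h₂ h₃ hl₁ hl₂ x hx => ?_⟩
  let a : ℝ → ℝ := fun ε => α + ε
  let l : ℝ → ℂ := fun ε => lam + ε * Complex.I
  have ha : Continuous a := by fun_prop
  have hl : Continuous l := by fun_prop
  have ha0 : a 0 = α := add_zero α
  have hl0 : l 0 = lam := by simp [l]
  have hL : ContinuousAt (fun ε => ExcLaguerre.omegaMaya M₁ M₂ (a ε) (l ε) x) 0 := by
    simp only [ExcLaguerre.omegaMaya_eq_omegaFinset]
    exact ExcLaguerre.continuousAt_omegaFinset _ _ _ _ hx ha.continuousAt hl.continuousAt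
      (ExcLaguerre.one_sub_add_natCast_ne_zero (by rwa [ha0]))
  have hC : ContinuousAt (fun ε => ExcLaguerre.omegaConj M₁.conjPartition M₂.conjPartition
      (a ε - M₁.conjShift - M₂.conjShift) (l ε + M₁.conjShift) x) 0 := by
    simp only [ExcLaguerre.omegaConj_eq_omegaFinset]
    exact ExcLaguerre.continuousAt_omegaFinset _ _ _ _ hx
      (α := fun ε => a ε - M₁.conjShift - M₂.conjShift)
      ((ha.continuousAt.sub continuousAt_const).sub continuousAt_const)
      (hl.continuousAt.add continuousAt_const)
      (ExcLaguerre.one_sub_add_natCast_ne_zero (by simpa only [ha0] using h₃))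
  have hD₁ : ContinuousAt (fun ε => ExcLaguerre.D₁ (a ε) (l ε) M₁) 0 :=
    ExcLaguerre.continuousAt_D₁ M₁ ha.continuousAt hl.continuousAt
      (ExcLaguerre.one_sub_add_natCast_ne_zero (by rwa [ha0])) (by rwa [hl0])
  have hD₂ : ContinuousAt (fun ε => ExcLaguerre.D₂ (a ε) (l ε) M₁.conjShift M₂) 0 := by
    simp only [ExcLaguerre.D₂_eq_D₁]
    refine ExcLaguerre.continuousAt_D₁ M₂ (α := fun ε => a ε - M₁.conjShift)
      (ha.continuousAt.sub continuousAt_const)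
      ((hl.continuousAt.neg.sub
        (ExcLaguerre.continuousAt_ofReal_comp ha.continuousAt)).sub continuousAt_const)
      (ExcLaguerre.one_sub_add_natCast_ne_zero (by simpa only [ha0] using h₂)) ?_
    intro k hk hkM h
    rw [ha0, hl0] at h
    exact hl₂ k hk hkM (by linear_combination -h)
  have hR : ContinuousAt (fun ε => (-1) ^ d * (ExcLaguerre.D₁ (a ε) (l ε) M₁ *
      ExcLaguerre.D₂ (a ε) (l ε) M₁.conjShift M₂ * ExcLaguerre.D₃ (a ε) M₁ M₂) *
        ExcLaguerre.omegaConj M₁.conjPartition M₂.conjPartition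
          (a ε - M₁.conjShift - M₂.conjShift) (l ε + M₁.conjShift) x) 0 :=
    (continuousAt_const.mul ((hD₁.mul hD₂).mul
      (ExcLaguerre.continuousAt_D₃ M₁ M₂ ha.continuousAt))).mul hC
  -- Generic `ε` accumulate at `0`, so the two continuous sides, equal there with the same `d`, have
  -- the same limit.
  have := mem_closure_iff_nhdsWithin_neBot.1 (ExcLaguerre.dense_generic α lam 0)
  have key := tendsto_nhds_unique_of_eventuallyEq (hL.mono_left nhdsWithin_le_nhds)
    (hR.mono_left nhdsWithin_le_nhds) (Filter.eventually_of_mem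
      (self_mem_nhdsWithin (s := {ε : ℝ | ExcLaguerre.Generic (α + ε) (lam + ε * Complex.I)}))
      fun ε hε => hd (a ε) (l ε) x hε hx)
  simpa only [ha0, hl0] using key
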